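/- Let $(\widetilde M, g, J)$ be a complex space form $\widetilde M(\mu)$ of real dimension $2m$, that is, a Kähler manifold ($g$ a Riemannian metric, $J$ a $g$-orthogonal almost complex structure with $\widetilde\nabla J=0$ for the Levi-Civita connection $\widetilde\nabla$ of $g$) of constant holomorphic sectional curvature $\mu$. Let $M$ be a non-empty $n$-dimensional ($n>1$) submanifold of $\widetilde M$ (isometrically immersed, with the induced metric) with Levi-Civita connection $\nabla$ and curvature tensor $R$, second fundamental form $\sigma(X,Y)=\widetilde\nabla_XY-\nabla_XY$, and normal connection $D_X\xi=(\widetilde\nabla_X\xi)^{\perp}$ with curvature tensor $R^\perp$. Assume that 1. $M$ is totally real: $J(T_pM)\subset T_pM^{\perp}$ for all $p\in M$; 2. $M$ is semiparallel: $R^\perp(X,Y)\sigma(Z,U)-\sigma(R(X,Y)Z,U)-\sigma(Z,R(X,Y)U)=0$ for all tangent vector fields $X,Y,Z,U$ on $M$; 3. $M$ is of constant sectional curvature $c$; 4. the $f$-structure in the normal bundle is parallel: if $f\xi$ denotes the normal component of $J\xi$ for a normal vector field $\xi$, then $D_X(f\xi)=f(D_X\xi)$ for all tangent $X$ and normal $\xi$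 (the case $f=0$ is allowed). Then either $c=0$ and $M$ is flat ($R=0$), or $M$ is totally geodesic ($\sigma=0$) and $c=\mu/4$. -/

import Mathlib

open Bundle FiberBundle VectorField Module
open scoped Manifold ContDiff Topology

noncomputable section

namespace TotallyReal

/-! ### The Levi-Civita connection of a Riemannian manifold -/

section RiemannianBundles

variable {EB : Type*} [NormedAddCommGroup EB] [NormedSpace ℝ EB]
  {HB : Type*} [TopologicalSpace HB] {IB : ModelWithCorners ℝ EB HB}
  {B : Type*} [TopologicalSpace B] [ChartedSpace HB B]
  {F : Type*} [NormedAddCommGroup F] [NormedSpace ℝ F] {V : B → Type*}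
  [TopologicalSpace (TotalSpace F V)] [∀ b, TopologicalSpace (V b)]
  [∀ b, AddCommGroup (V b)] [∀ b, Module ℝ (V b)]
  [∀ b, IsTopologicalAddGroup (V b)] [∀ b, ContinuousConstSMul ℝ (V b)]
  [FiberBundle F V] [VectorBundle ℝ F V] [RiemannianBundle V]
  [IsContMDiffRiemannianBundle IB 1 F V]

theorem mdifferentiableAt_inner_bundle {x : B} {X Y : Π x, V x}
    (hX : MDiffAt (T% X) x) (hY : MDiffAt (T% Y) x) :
    MDiffAt (fun q ↦ inner ℝ (X q) (Y q)) x :=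
  hX.inner_bundle hY

end RiemannianBundles

section LeviCivita

variable {E : Type*} [NormedAddCommGroup E] [NormedSpace ℝ E]
  {M : Type*} [TopologicalSpace M] [ChartedSpace E M]

instance tangentSpace_finiteDimensional [FiniteDimensional ℝ E] (x : M) :
    FiniteDimensional ℝ (TangentSpace 𝓘(ℝ, E) x) :=
  inferInstanceAs (FiniteDimensional ℝ E)

variable [IsManifold 𝓘(ℝ, E) ∞ M]
  [RiemannianBundle (fun x : M ↦ TangentSpace 𝓘(ℝ, E) x)]

instance tangentSpace_completeSpace [FiniteDimensional ℝ E] (x : M) :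
    CompleteSpace (TangentSpace 𝓘(ℝ, E) x) :=
  FiniteDimensional.complete ℝ _

/-- The right-hand side of the Koszul formula for `⟨∇_X Y, Z⟩` at the point `x`. -/
def koszul (Y X Z : Π x : M, TangentSpace 𝓘(ℝ, E) x) (x : M) : ℝ :=
  (1 / 2) * (d% (fun q ↦ inner ℝ (Y q) (Z q)) x (X x)
    + d% (fun q ↦ inner ℝ (X q) (Z q)) x (Y x)
    - d% (fun q ↦ inner ℝ (X q) (Y q)) x (Z x)
    + inner ℝ (mlieBracket 𝓘(ℝ, E) X Y x) (Z x)
    - inner ℝ (mlieBracket 𝓘(ℝ, E) X Z x) (Y x)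
    - inner ℝ (mlieBracket 𝓘(ℝ, E) Y Z x) (X x))

variable [IsContMDiffRiemannianBundle 𝓘(ℝ, E) ∞ E (fun x : M ↦ TangentSpace 𝓘(ℝ, E) x)]
  {x : M} {X Y Z : Π x : M, TangentSpace 𝓘(ℝ, E) x}

theorem mdifferentiableAt_inner (hX : MDiffAt (T% X) x) (hY : MDiffAt (T% Y) x) :
    MDiffAt (fun q ↦ inner ℝ (X q) (Y q)) x :=
  mdifferentiableAt_inner_bundle hX hY

variable [FiniteDimensional ℝ E]

theorem tensorialAt_koszul_left (hY : MDiffAt (T% Y) x) (hZ : MDiffAt (T% Z) x) :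
    TensorialAt 𝓘(ℝ, E) E (fun X ↦ koszul Y X Z x) x where
  smul {f X} hf hX := by
    have h1 := mvfderiv_fun_mul hf (mdifferentiableAt_inner hX hZ)
    have h2 := mvfderiv_fun_mul hf (mdifferentiableAt_inner hX hY)
    simp [koszul, inner_smul_left, inner_smul_right, inner_add_left, h1, h2,
      mlieBracket_smul_left hf hX]
    ring
  add {X X'} hX hX' := by
    have h1 := mvfderiv_fun_add (mdifferentiableAt_inner hX hZ) (mdifferentiableAt_inner hX' hZ)
    have h2 := mvfderiv_fun_add (mdifferentiableAt_inner hX hY) (mdifferentiableAt_inner hX' hY)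
    simp [koszul, inner_add_left, inner_add_right, h1, h2, mlieBracket_add_left hX hX']
    ring

theorem tensorialAt_koszul_right (hY : MDiffAt (T% Y) x) (hX : MDiffAt (T% X) x) :
    TensorialAt 𝓘(ℝ, E) E (fun Z ↦ koszul Y X Z x) x where
  smul {f Z} hf hZ := by
    have h1 := mvfderiv_fun_mul hf (mdifferentiableAt_inner hY hZ)
    have h2 := mvfderiv_fun_mul hf (mdifferentiableAt_inner hX hZ)
    simp [koszul, inner_smul_left, inner_smul_right, inner_add_left, h1, h2,
      mlieBracket_smul_right hf hZ]
    rw [real_inner_comm (Y x) (Z x), real_inner_comm (X x) (Z x)]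
    ring
  add {Z Z'} hZ hZ' := by
    have h1 := mvfderiv_fun_add (mdifferentiableAt_inner hY hZ) (mdifferentiableAt_inner hY hZ')
    have h2 := mvfderiv_fun_add (mdifferentiableAt_inner hX hZ) (mdifferentiableAt_inner hX hZ')
    simp [koszul, inner_add_left, inner_add_right, h1, h2, mlieBracket_add_right hZ hZ']
    ring

theorem koszul_add {Y' : Π x : M, TangentSpace 𝓘(ℝ, E) x} (hX : MDiffAt (T% X) x)
    (hY : MDiffAt (T% Y) x) (hY' : MDiffAt (T% Y') x) (hZ : MDiffAt (T% Z) x) :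
    koszul (Y + Y') X Z x = koszul Y X Z x + koszul Y' X Z x := by
  have h1 := mvfderiv_fun_add (mdifferentiableAt_inner hY hZ) (mdifferentiableAt_inner hY' hZ)
  have h2 := mvfderiv_fun_add (mdifferentiableAt_inner hX hY) (mdifferentiableAt_inner hX hY')
  simp [koszul, inner_add_left, inner_add_right, h1, h2, mlieBracket_add_left hY hY',
    mlieBracket_add_right hY hY']
  ring

theorem koszul_smul {f : M → ℝ} (hf : MDiffAt f x) (hX : MDiffAt (T% X) x)
    (hY : MDiffAt (T% Y) x) (hZ : MDiffAt (T% Z) x) :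
    koszul (f • Y) X Z x = f x * koszul Y X Z x + d% f x (X x) * inner ℝ (Y x) (Z x) := by
  have h1 := mvfderiv_fun_mul hf (mdifferentiableAt_inner hY hZ)
  have h2 := mvfderiv_fun_mul hf (mdifferentiableAt_inner hX hY)
  simp [koszul, inner_add_left, inner_smul_left, inner_smul_right, h1, h2,
    mlieBracket_smul_left hf hY, mlieBracket_smul_right hf hY]
  rw [real_inner_comm (X x) (Y x)]
  ring

/-- The bilinear form `(u, w) ↦ ⟨∇_u Y, w⟩` on the tangent space at `x`. -/
def koszulForm (Y : Π x : M, TangentSpace 𝓘(ℝ, E) x) (x : M) (hY : MDiffAt (T% Y) x) :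
    TangentSpace 𝓘(ℝ, E) x →L[ℝ] TangentSpace 𝓘(ℝ, E) x →L[ℝ] ℝ :=
  TensorialAt.mkHom₂ (I := 𝓘(ℝ, E)) (F := E) (F' := E) (fun X Z ↦ koszul Y X Z x) x
    (fun _ hZ ↦ tensorialAt_koszul_left hY hZ) (fun _ hX ↦ tensorialAt_koszul_right hY hX)

open scoped Classical in
/-- `u ↦ ∇_u Y` at `x`, the vector dual to the Koszul form. The value at a point where the vector
field `Y` is not differentiable is irrelevant. -/
def leviCivitaFun (Y : Π x : M, TangentSpace 𝓘(ℝ, E) x) (x : M) :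
    TangentSpace 𝓘(ℝ, E) x →L[ℝ] TangentSpace 𝓘(ℝ, E) x :=
  if hY : MDiffAt (T% Y) x then
    LinearMap.toContinuousLinearMap
      { toFun v := (InnerProductSpace.toDual ℝ (TangentSpace 𝓘(ℝ, E) x)).symm (koszulForm Y x hY v)
        map_add' := by simp
        map_smul' := by simp }
  else 0

/-- The Koszul formula. -/
theorem inner_leviCivitaFun (hX : MDiffAt (T% X) x) (hY : MDiffAt (T% Y) x)
    (hZ : MDiffAt (T% Z) x) :
    inner ℝ (leviCivitaFun Y x (X x)) (Z x) = koszul Y X Z x := by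
  have h : koszulForm Y x hY (X x) (Z x) = koszul Y X Z x :=
    TensorialAt.mkHom₂_apply _ _ hX hZ
  simp [leviCivitaFun, hY, h]

theorem leviCivitaFun_isCovariantDerivativeOn :
    IsCovariantDerivativeOn (I := 𝓘(ℝ, E)) (V := fun x : M ↦ TangentSpace 𝓘(ℝ, E) x) E
      leviCivitaFun Set.univ where
  add {Y Y' x} hY hY' _ := by
    ext1 v
    refine ext_inner_right ℝ fun w ↦ ?_
    have hv := mdifferentiableAt_extend 𝓘(ℝ, E) E v
    have hw := mdifferentiableAt_extend 𝓘(ℝ, E) E w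
    have hs := mdifferentiableAt_add_section hY hY'
    have e1 := inner_leviCivitaFun hv hs hw
    have e2 := inner_leviCivitaFun hv hY hw
    have e3 := inner_leviCivitaFun hv hY' hw
    simp only [extend_apply_self] at e1 e2 e3
    rw [e1, koszul_add hv hY hY' hw, ← e2, ← e3, ← inner_add_left]
    rfl
  leibniz {Y g x} hY hg _ := by
    ext1 v
    refine ext_inner_right ℝ fun w ↦ ?_
    have hv := mdifferentiableAt_extend 𝓘(ℝ, E) E v
    have hw := mdifferentiableAt_extend 𝓘(ℝ, E) E w
    have hs := hg.smul_section hY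
    have e1 := inner_leviCivitaFun hv hs hw
    have e2 := inner_leviCivitaFun hv hY hw
    have e3 := koszul_smul hg hv hY hw
    simp only [extend_apply_self] at e1 e2 e3
    rw [e1, e3, ← e2, ← real_inner_smul_left, ← real_inner_smul_left, ← inner_add_left]
    rfl

/-- The Levi-Civita connection of the Riemannian manifold `M`, given by the Koszul formula.
`leviCivita Y x (X x)` is `∇_X Y` at the point `x`. -/
def leviCivita : CovariantDerivative 𝓘(ℝ, E) E (fun x : M ↦ TangentSpace 𝓘(ℝ, E) x) :=
  ⟨leviCivitaFun, leviCivitaFun_isCovariantDerivativeOn⟩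

/-- The Levi-Civita connection is torsion free. -/
theorem leviCivita_torsion (hX : MDiffAt (T% X) x) (hY : MDiffAt (T% Y) x) :
    leviCivita Y x (X x) - leviCivita X x (Y x) = mlieBracket 𝓘(ℝ, E) X Y x := by
  refine ext_inner_right ℝ fun w ↦ ?_
  have hw := mdifferentiableAt_extend 𝓘(ℝ, E) E w
  have e1 := inner_leviCivitaFun hX hY hw
  have e2 := inner_leviCivitaFun hY hX hw
  simp only [extend_apply_self] at e1 e2
  have h : (fun q ↦ inner ℝ (X q) (Y q)) = fun q ↦ inner ℝ (Y q) (X q) :=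
    funext fun q ↦ real_inner_comm _ _
  rw [inner_sub_left]
  change inner ℝ (leviCivitaFun Y x (X x)) w - inner ℝ (leviCivitaFun X x (Y x)) w = _
  rw [e1, e2, koszul, koszul, h, mlieBracket_swap_apply (V := Y) (W := X)]
  simp only [extend_apply_self, inner_neg_left]
  ring

/-- The Levi-Civita connection is compatible with the metric. -/
theorem leviCivita_metric (hX : MDiffAt (T% X) x) (hY : MDiffAt (T% Y) x)
    (hZ : MDiffAt (T% Z) x) :
    d% (fun q ↦ inner ℝ (Y q) (Z q)) x (X x) =
      inner ℝ (leviCivita Y x (X x)) (Z x) + inner ℝ (Y x) (leviCivita Z x (X x)) := by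
  have e1 := inner_leviCivitaFun hX hY hZ
  have e2 := inner_leviCivitaFun hX hZ hY
  have h : (fun q ↦ inner ℝ (Y q) (Z q)) = fun q ↦ inner ℝ (Z q) (Y q) :=
    funext fun q ↦ real_inner_comm _ _
  rw [real_inner_comm (leviCivita Z x (X x)) (Y x)]
  change _ = inner ℝ (leviCivitaFun Y x (X x)) (Z x) + inner ℝ (leviCivitaFun Z x (X x)) (Y x)
  rw [e1, e2, koszul, koszul, h, mlieBracket_swap_apply (V := Z) (W := Y)]
  simp only [inner_neg_left]
  ring

/-! ### Curvature

Vector fields are arbitrary families of tangent vectors; a condition on the value at `p` of an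
expression in vector fields is imposed for all fields that are `C^∞` at `p`. -/

/-- The curvature `R(X, Y)Z = ∇_X ∇_Y Z - ∇_Y ∇_X Z - ∇_[X,Y] Z` of the Levi-Civita connection. -/
def curvature (X Y Z : Π x : M, TangentSpace 𝓘(ℝ, E) x) (p : M) : TangentSpace 𝓘(ℝ, E) p :=
  leviCivita (fun q ↦ leviCivita Z q (Y q)) p (X p)
    - leviCivita (fun q ↦ leviCivita Z q (X q)) p (Y p)
    - leviCivita Z p (mlieBracket 𝓘(ℝ, E) X Y p)

/-- The sectional curvature of the plane spanned by `X p` and `Y p`. -/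
def sectionalCurvature (X Y : Π x : M, TangentSpace 𝓘(ℝ, E) x) (p : M) : ℝ :=
  inner ℝ (curvature X Y Y p) (X p) /
    (inner ℝ (X p) (X p) * inner ℝ (Y p) (Y p) - inner ℝ (X p) (Y p) ^ 2)

variable (E M) in
/-- The Riemannian manifold `M` is of constant (sectional) curvature `c`. -/
def HasConstantCurvature (c : ℝ) : Prop :=
  ∀ (p : M) (X Y : Π x : M, TangentSpace 𝓘(ℝ, E) x),
    CMDiffAt ∞ (T% X) p → CMDiffAt ∞ (T% Y) p → LinearIndependent ℝ ![X p, Y p] →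
      sectionalCurvature X Y p = c

variable (E M) in
/-- The Riemannian manifold `M` is flat: its curvature tensor vanishes. -/
def IsFlat : Prop :=
  ∀ (p : M) (X Y Z : Π x : M, TangentSpace 𝓘(ℝ, E) x),
    CMDiffAt ∞ (T% X) p → CMDiffAt ∞ (T% Y) p → CMDiffAt ∞ (T% Z) p → curvature X Y Z p = 0

/-! ### Kähler manifolds and complex space forms -/

/-- `J` is a Kähler structure on the Riemannian manifold `M`: a smooth field of orthogonal complex
structures on the tangent spaces with `(∇_X J) Y = ∇_X (J Y) - J (∇_X Y) = 0`. -/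
structure IsKaehler (J : Π x : M, TangentSpace 𝓘(ℝ, E) x →L[ℝ] TangentSpace 𝓘(ℝ, E) x) :
    Prop where
  smooth : ContMDiff 𝓘(ℝ, E) (𝓘(ℝ, E).prod 𝓘(ℝ, E →L[ℝ] E)) ∞
    (fun x ↦ TotalSpace.mk' (E →L[ℝ] E)
      (E := fun x : M ↦ TangentSpace 𝓘(ℝ, E) x →L[ℝ] TangentSpace 𝓘(ℝ, E) x) x (J x))
  sq : ∀ (x : M) (v : TangentSpace 𝓘(ℝ, E) x), J x (J x v) = -v
  isometry : ∀ (x : M) (v w : TangentSpace 𝓘(ℝ, E) x), inner ℝ (J x v) (J x w) = inner ℝ v w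
  parallel : ∀ (x : M) (v : TangentSpace 𝓘(ℝ, E) x) (Y : Π x : M, TangentSpace 𝓘(ℝ, E) x),
    CMDiffAt ∞ (T% Y) x → leviCivita (fun q ↦ J q (Y q)) x v = J x (leviCivita Y x v)

/-- `(M, J)` is a complex space form `M(μ)`: a Kähler manifold of constant holomorphic sectional
curvature `μ`. -/
structure IsComplexSpaceForm
    (J : Π x : M, TangentSpace 𝓘(ℝ, E) x →L[ℝ] TangentSpace 𝓘(ℝ, E) x) (μ : ℝ) : Prop where
  isKaehler : IsKaehler J
  holomorphic_curvature : ∀ (p : M) (X : Π x : M, TangentSpace 𝓘(ℝ, E) x),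
    CMDiffAt ∞ (T% X) p → X p ≠ 0 → sectionalCurvature X (fun q ↦ J q (X q)) p = μ

end LeviCivita

/-! ### Submanifolds

A submanifold of `N` is a smooth isometric immersion `F : M → N`; the tangent space `T_p M` is regarded
as the subspace `dF(T_p M)` of `T_{F p} N`. -/

section Submanifold

variable {E : Type*} [NormedAddCommGroup E] [NormedSpace ℝ E]
  {M : Type*} [TopologicalSpace M] [ChartedSpace E M]
  {E' : Type*} [NormedAddCommGroup E'] [NormedSpace ℝ E']
  {N : Type*} [TopologicalSpace N] [ChartedSpace E' N]

/-- The differential `dF : T_p M → T_{F p} N`. -/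
abbrev differential (F : C^∞⟮𝓘(ℝ, E), M; 𝓘(ℝ, E'), N⟯) (p : M) :
    TangentSpace 𝓘(ℝ, E) p →L[ℝ] TangentSpace 𝓘(ℝ, E') (F p) :=
  mfderiv 𝓘(ℝ, E) 𝓘(ℝ, E') F p

/-- The vector field `V` along `F` is of class `C^∞` at `p`. -/
def SmoothAlongAt [IsManifold 𝓘(ℝ, E') ∞ N] (F : C^∞⟮𝓘(ℝ, E), M; 𝓘(ℝ, E'), N⟯)
    (V : Π q : M, TangentSpace 𝓘(ℝ, E') (F q)) (p : M) : Prop :=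
  ContMDiffAt 𝓘(ℝ, E) (𝓘(ℝ, E').prod 𝓘(ℝ, E')) ∞
    (fun q ↦ TotalSpace.mk' E' (E := fun x : N ↦ TangentSpace 𝓘(ℝ, E') x) (F q) (V q)) p

variable [IsManifold 𝓘(ℝ, E') ∞ N] [RiemannianBundle (fun x : N ↦ TangentSpace 𝓘(ℝ, E') x)]

section Normal

variable [FiniteDimensional ℝ E']

/-- The normal space `T_p M^⊥` in `T_{F p} N`. -/
def normalSpace (F : C^∞⟮𝓘(ℝ, E), M; 𝓘(ℝ, E'), N⟯) (p : M) : Submodule ℝ (TangentSpace 𝓘(ℝ, E') (F p)) :=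
  (LinearMap.range (differential F p).toLinearMap)ᗮ

/-- The normal component of a tangent vector of `N` at `F p`. -/
def normalPart (F : C^∞⟮𝓘(ℝ, E), M; 𝓘(ℝ, E'), N⟯) (p : M) (v : TangentSpace 𝓘(ℝ, E') (F p)) :
    TangentSpace 𝓘(ℝ, E') (F p) :=
  (normalSpace F p).starProjection v

/-- The endomorphism `f` of the normal bundle: `f ξ` is the normal component of `J ξ`. -/
def normalF (J : Π x : N, TangentSpace 𝓘(ℝ, E') x →L[ℝ] TangentSpace 𝓘(ℝ, E') x) (F : C^∞⟮𝓘(ℝ, E), M; 𝓘(ℝ, E'), N⟯)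
    (p : M) (v : TangentSpace 𝓘(ℝ, E') (F p)) : TangentSpace 𝓘(ℝ, E') (F p) :=
  normalPart F p (J (F p) v)

end Normal

/-- `F` is a totally real submanifold: `J T_p M ⊆ T_p M^⊥` for all `p`. -/
def IsTotallyReal (J : Π x : N, TangentSpace 𝓘(ℝ, E') x →L[ℝ] TangentSpace 𝓘(ℝ, E') x)
    (F : C^∞⟮𝓘(ℝ, E), M; 𝓘(ℝ, E'), N⟯) : Prop :=
  ∀ (p : M) (v : TangentSpace 𝓘(ℝ, E) p), J (F p) (differential F p v) ∈ normalSpace F p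

variable [FiniteDimensional ℝ E']
  [IsContMDiffRiemannianBundle 𝓘(ℝ, E') ∞ E' (fun x : N ↦ TangentSpace 𝓘(ℝ, E') x)]

/-- The covariant derivative `u ↦ ∇~_u V` at `p` of a vector field `V` along `F`, for the
Levi-Civita connection `∇~` of `N`. In the chart of `N` at `F p`, if `V = ∑ a, V^a ∂_a`, then
`∇~_u V = ∑ a, u(V^a) ∂_a + ∑ a, V^a(p) ∇~_{dF u} ∂_a`; here `extend E' (V p)` is the vector field
`∑ a, V^a(p) ∂_a` near `F p`. -/
def covDerivAlong (F : C^∞⟮𝓘(ℝ, E), M; 𝓘(ℝ, E'), N⟯) (V : Π q : M, TangentSpace 𝓘(ℝ, E') (F q)) (p : M) :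
    TangentSpace 𝓘(ℝ, E) p →L[ℝ] TangentSpace 𝓘(ℝ, E') (F p) :=
  letI t := trivializationAt E' (fun x : N ↦ TangentSpace 𝓘(ℝ, E') x) (F p)
  (t.symmL ℝ (F p)).comp (d% (fun q ↦ (t ⟨F q, V q⟩).2) p)
    + (leviCivita (extend E' (V p)) (F p)).comp (differential F p)

/-- The connection of the normal bundle: `normalConn F ξ p (X p)` is `D_X ξ` at `p`, the normal
component of `∇~_X ξ`. -/
def normalConn (F : C^∞⟮𝓘(ℝ, E), M; 𝓘(ℝ, E'), N⟯) (ξ : Π q : M, TangentSpace 𝓘(ℝ, E') (F q)) (p : M)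
    (u : TangentSpace 𝓘(ℝ, E) p) : TangentSpace 𝓘(ℝ, E') (F p) :=
  normalPart F p (covDerivAlong F ξ p u)

/-- The `f`-structure in the normal bundle is parallel: `D_X (f ξ) = f (D_X ξ)` for all normal
vector fields `ξ`. -/
def HasParallelNormalF
    (J : Π x : N, TangentSpace 𝓘(ℝ, E') x →L[ℝ] TangentSpace 𝓘(ℝ, E') x) (F : C^∞⟮𝓘(ℝ, E), M; 𝓘(ℝ, E'), N⟯) : Prop :=
  ∀ (p : M) (u : TangentSpace 𝓘(ℝ, E) p) (ξ : Π q : M, TangentSpace 𝓘(ℝ, E') (F q)),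
    (∀ q, ξ q ∈ normalSpace F q) → SmoothAlongAt F ξ p →
      normalConn F (fun q ↦ normalF J F q (ξ q)) p u = normalF J F p (normalConn F ξ p u)

/-- The curvature of the normal connection,
`R^⊥(X, Y)ξ = D_X D_Y ξ - D_Y D_X ξ - D_[X,Y] ξ`. -/
def normalCurvature (F : C^∞⟮𝓘(ℝ, E), M; 𝓘(ℝ, E'), N⟯) (X Y : Π q : M, TangentSpace 𝓘(ℝ, E) q)
    (ξ : Π q : M, TangentSpace 𝓘(ℝ, E') (F q)) (p : M) : TangentSpace 𝓘(ℝ, E') (F p) :=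
  normalConn F (fun q ↦ normalConn F ξ q (Y q)) p (X p)
    - normalConn F (fun q ↦ normalConn F ξ q (X q)) p (Y p)
    - normalConn F ξ p (mlieBracket 𝓘(ℝ, E) X Y p)

variable [IsManifold 𝓘(ℝ, E) ∞ M]
  [RiemannianBundle (fun x : M ↦ TangentSpace 𝓘(ℝ, E) x)]

/-- `F` is an isometric immersion, i.e. the metric of `M` is the one induced by `F`. -/
def IsIsometricImmersion (F : C^∞⟮𝓘(ℝ, E), M; 𝓘(ℝ, E'), N⟯) : Prop :=
  ∀ (p : M) (u v : TangentSpace 𝓘(ℝ, E) p),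
    inner ℝ (differential F p u) (differential F p v) = inner ℝ u v

variable [IsContMDiffRiemannianBundle 𝓘(ℝ, E) ∞ E (fun x : M ↦ TangentSpace 𝓘(ℝ, E) x)]
  [FiniteDimensional ℝ E]

/-- The second fundamental form, given by the Gauss formula `∇~_X Y = ∇_X Y + σ(X, Y)`, where `∇`
is the Levi-Civita connection of `M`. -/
def secondFundamentalForm (F : C^∞⟮𝓘(ℝ, E), M; 𝓘(ℝ, E'), N⟯) (X Y : Π q : M, TangentSpace 𝓘(ℝ, E) q) (p : M) :
    TangentSpace 𝓘(ℝ, E') (F p) :=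
  covDerivAlong F (fun q ↦ differential F q (Y q)) p (X p)
    - differential F p (leviCivita Y p (X p))

/-- `F` is a totally geodesic submanifold: `σ = 0`. -/
def IsTotallyGeodesic (F : C^∞⟮𝓘(ℝ, E), M; 𝓘(ℝ, E'), N⟯) : Prop :=
  ∀ (p : M) (X Y : Π q : M, TangentSpace 𝓘(ℝ, E) q),
    CMDiffAt ∞ (T% X) p → CMDiffAt ∞ (T% Y) p → secondFundamentalForm F X Y p = 0

/-- `F` is a semiparallel submanifold:
`R^⊥(X, Y)σ(Z, U) - σ(R(X, Y)Z, U) - σ(Z, R(X, Y)U) = 0`. -/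
def IsSemiparallel (F : C^∞⟮𝓘(ℝ, E), M; 𝓘(ℝ, E'), N⟯) : Prop :=
  ∀ (p : M) (X Y Z U : Π q : M, TangentSpace 𝓘(ℝ, E) q),
    CMDiffAt ∞ (T% X) p → CMDiffAt ∞ (T% Y) p → CMDiffAt ∞ (T% Z) p → CMDiffAt ∞ (T% U) p →
      normalCurvature F X Y (secondFundamentalForm F Z U) p
        - secondFundamentalForm F (curvature X Y Z) U p
        - secondFundamentalForm F Z (curvature X Y U) p = 0

end Submanifold

end TotallyReal
end

/-!
Total reality makes the fields `J dF Y` normal, and `f` annihilates them. As `f` is parallel, this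
gives `f² σ = 0`; as `f` is skew-symmetric, `f σ = 0`, so that `σ` takes values in `J TM` and is
determined by the cubic form `C(u, v, w) = ⟨σ(u, v), J w⟩`. This form is totally symmetric, because
`J` is parallel. Moreover `D_X (J Y) = J ∇_X Y`, hence `R^⊥(X, Y) J Z = J R(X, Y) Z`, and
semiparallelity says that `R(X, Y)`, acting as a derivation, annihilates `C`.

If the constant curvature `c` is nonzero, then `C` is invariant under all rotations of `T_p M`. A
symmetric cubic form invariant under rotations vanishes in dimension greater than one, so `σ = 0`.
The curvature of `M` is then the restriction of the ambient one, which equals `μ / 4` on totally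
real planes of a complex space form.
-/

noncomputable section

namespace TotallyReal

/-! ### Vector fields along a map -/

theorem eventually_mdifferentiableAt {E : Type*} [NormedAddCommGroup E] [NormedSpace ℝ E]
    {H : Type*} [TopologicalSpace H] {I : ModelWithCorners ℝ E H}
    {M : Type*} [TopologicalSpace M] [ChartedSpace H M] [IsManifold I 1 M]
    {E' : Type*} [NormedAddCommGroup E'] [NormedSpace ℝ E']
    {H' : Type*} [TopologicalSpace H'] {I' : ModelWithCorners ℝ E' H'}
    {M' : Type*} [TopologicalSpace M'] [ChartedSpace H' M'] [IsManifold I' 1 M']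
    {f : M → M'} {p : M} (hf : ContMDiffAt I I' 1 f p) :
    ∀ᶠ q in 𝓝 p, MDifferentiableAt I I' f q :=
  ((contMDiffAt_iff_contMDiffAt_nhds (by simp)).1 hf).mono fun _ hq ↦
    hq.mdifferentiableAt (by simp)

section Along

variable {E : Type*} [NormedAddCommGroup E] [NormedSpace ℝ E]
  {M : Type*} [TopologicalSpace M] [ChartedSpace E M]
  {E' : Type*} [NormedAddCommGroup E'] [NormedSpace ℝ E']
  {N : Type*} [TopologicalSpace N] [ChartedSpace E' N] [IsManifold 𝓘(ℝ, E') ∞ N]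
  {F : C^∞⟮𝓘(ℝ, E), M; 𝓘(ℝ, E'), N⟯} {p : M}

theorem differential_id (x : M) (u : TangentSpace 𝓘(ℝ, E) x) :
    differential (.id : C^∞⟮𝓘(ℝ, E), M; 𝓘(ℝ, E), M⟯) x u = u :=
  congrArg (fun L : E →L[ℝ] E ↦ L u) (mfderiv_id (I := 𝓘(ℝ, E)) (x := x))

/-- The vector field `V` along `F` is differentiable at `p`. -/
def MDiffAlongAt (F : C^∞⟮𝓘(ℝ, E), M; 𝓘(ℝ, E'), N⟯)
    (V : Π q : M, TangentSpace 𝓘(ℝ, E') (F q)) (p : M) : Prop :=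
  MDifferentiableAt 𝓘(ℝ, E) (𝓘(ℝ, E').prod 𝓘(ℝ, E'))
    (fun q ↦ TotalSpace.mk' E' (E := fun x : N ↦ TangentSpace 𝓘(ℝ, E') x) (F q) (V q)) p

/-- The coordinates of the vector field `V` along `F` in the chart of `N` at `F p`. -/
def coordAlong (F : C^∞⟮𝓘(ℝ, E), M; 𝓘(ℝ, E'), N⟯) (p : M)
    (V : Π q : M, TangentSpace 𝓘(ℝ, E') (F q)) (q : M) : E' :=
  (trivializationAt E' (fun x : N ↦ TangentSpace 𝓘(ℝ, E') x) (F p) ⟨F q, V q⟩).2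

theorem mdiffAlongAt_iff {V : Π q : M, TangentSpace 𝓘(ℝ, E') (F q)} :
    MDiffAlongAt F V p ↔ MDiffAt (coordAlong F p V) p := by
  unfold MDiffAlongAt coordAlong
  rw [mdifferentiableAt_totalSpace]
  exact and_iff_right (F.contMDiff.mdifferentiableAt (by simp))

theorem smoothAlongAt_iff {V : Π q : M, TangentSpace 𝓘(ℝ, E') (F q)} :
    SmoothAlongAt F V p ↔ CMDiffAt ∞ (coordAlong F p V) p := by
  unfold SmoothAlongAt coordAlong
  rw [contMDiffAt_totalSpace]
  exact and_iff_right F.contMDiff.contMDiffAt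

theorem SmoothAlongAt.mdiffAlongAt {V : Π q : M, TangentSpace 𝓘(ℝ, E') (F q)}
    (h : SmoothAlongAt F V p) : MDiffAlongAt F V p :=
  ContMDiffAt.mdifferentiableAt h (by simp)

theorem SmoothAlongAt.eventually_mdiffAlongAt [IsManifold 𝓘(ℝ, E) ∞ M]
    {V : Π q : M, TangentSpace 𝓘(ℝ, E') (F q)}
    (h : SmoothAlongAt F V p) : ∀ᶠ q in 𝓝 p, MDiffAlongAt F V q :=
  eventually_mdifferentiableAt (ContMDiffAt.of_le h (by simp))

theorem eventually_mem_baseSet (F : C^∞⟮𝓘(ℝ, E), M; 𝓘(ℝ, E'), N⟯) (p : M) :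
    ∀ᶠ q in 𝓝 p,
      F q ∈ (trivializationAt E' (fun x : N ↦ TangentSpace 𝓘(ℝ, E') x) (F p)).baseSet :=
  F.contMDiff.continuous.continuousAt.eventually_mem
    ((Trivialization.open_baseSet _).mem_nhds (mem_baseSet_trivializationAt' _))

theorem coordAlong_add {V W : Π q : M, TangentSpace 𝓘(ℝ, E') (F q)} :
    coordAlong F p (fun q ↦ V q + W q) =ᶠ[𝓝 p]
      fun q ↦ coordAlong F p V q + coordAlong F p W q :=
  (eventually_mem_baseSet F p).mono fun _ hq ↦
    ((trivializationAt E' (fun x : N ↦ TangentSpace 𝓘(ℝ, E') x) (F p)).linear ℝ hq).map_add _ _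

theorem coordAlong_smul {f : M → ℝ} {V : Π q : M, TangentSpace 𝓘(ℝ, E') (F q)} :
    coordAlong F p (fun q ↦ f q • V q) =ᶠ[𝓝 p] fun q ↦ f q • coordAlong F p V q :=
  (eventually_mem_baseSet F p).mono fun _ hq ↦
    ((trivializationAt E' (fun x : N ↦ TangentSpace 𝓘(ℝ, E') x) (F p)).linear ℝ hq).map_smul _ _

theorem coordAlong_congr {V W : Π q : M, TangentSpace 𝓘(ℝ, E') (F q)}
    (h : ∀ᶠ q in 𝓝 p, V q = W q) : coordAlong F p V =ᶠ[𝓝 p] coordAlong F p W :=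
  h.mono fun q hq ↦ by simp [coordAlong, hq]

variable {V W : Π q : M, TangentSpace 𝓘(ℝ, E') (F q)} {f : M → ℝ}

theorem SmoothAlongAt.congr (hV : SmoothAlongAt F V p) (h : ∀ᶠ q in 𝓝 p, V q = W q) :
    SmoothAlongAt F W p :=
  smoothAlongAt_iff.2 <| (smoothAlongAt_iff.1 hV).congr_of_eventuallyEq (coordAlong_congr h).symm

theorem MDiffAlongAt.congr (hV : MDiffAlongAt F V p) (h : ∀ᶠ q in 𝓝 p, V q = W q) :
    MDiffAlongAt F W p :=
  mdiffAlongAt_iff.2 <| (mdiffAlongAt_iff.1 hV).congr_of_eventuallyEq (coordAlong_congr h).symm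

theorem MDiffAlongAt.add (hV : MDiffAlongAt F V p) (hW : MDiffAlongAt F W p) :
    MDiffAlongAt F (fun q ↦ V q + W q) p :=
  mdiffAlongAt_iff.2 <|
    ((mdiffAlongAt_iff.1 hV).add (mdiffAlongAt_iff.1 hW)).congr_of_eventuallyEq coordAlong_add

theorem SmoothAlongAt.add (hV : SmoothAlongAt F V p) (hW : SmoothAlongAt F W p) :
    SmoothAlongAt F (fun q ↦ V q + W q) p :=
  smoothAlongAt_iff.2 <|
    ((smoothAlongAt_iff.1 hV).add (smoothAlongAt_iff.1 hW)).congr_of_eventuallyEq coordAlong_add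

theorem MDiffAlongAt.smul (hf : MDiffAt f p) (hV : MDiffAlongAt F V p) :
    MDiffAlongAt F (fun q ↦ f q • V q) p :=
  mdiffAlongAt_iff.2 <|
    (hf.smul (mdiffAlongAt_iff.1 hV)).congr_of_eventuallyEq coordAlong_smul

theorem SmoothAlongAt.smul (hf : CMDiffAt ∞ f p) (hV : SmoothAlongAt F V p) :
    SmoothAlongAt F (fun q ↦ f q • V q) p :=
  smoothAlongAt_iff.2 <|
    (hf.smul (smoothAlongAt_iff.1 hV)).congr_of_eventuallyEq coordAlong_smul

theorem SmoothAlongAt.neg (hV : SmoothAlongAt F V p) : SmoothAlongAt F (fun q ↦ -V q) p :=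
  (hV.smul (f := fun _ ↦ -1) contMDiffAt_const).congr (.of_forall fun q ↦ neg_one_smul ℝ (V q))

theorem SmoothAlongAt.sub (hV : SmoothAlongAt F V p) (hW : SmoothAlongAt F W p) :
    SmoothAlongAt F (fun q ↦ V q - W q) p :=
  (hV.add hW.neg).congr (.of_forall fun q ↦ (sub_eq_add_neg (V q) (W q)).symm)

theorem MDiffAlongAt.comp {S : Π x : N, TangentSpace 𝓘(ℝ, E') x} (hS : MDiffAt (T% S) (F p)) :
    MDiffAlongAt F (fun q ↦ S (F q)) p :=
  MDifferentiableAt.comp (g := T% S) (f := F) p hS (F.contMDiff.mdifferentiableAt (by simp))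

theorem SmoothAlongAt.comp {S : Π x : N, TangentSpace 𝓘(ℝ, E') x} (hS : CMDiffAt ∞ (T% S) (F p)) :
    SmoothAlongAt F (fun q ↦ S (F q)) p :=
  ContMDiffAt.comp (g := T% S) (f := F) p hS F.contMDiff.contMDiffAt

theorem SmoothAlongAt.differential [IsManifold 𝓘(ℝ, E) ∞ M] {X : Π q : M, TangentSpace 𝓘(ℝ, E) q}
    (hX : CMDiffAt ∞ (T% X) p) :
    SmoothAlongAt F (fun q ↦ differential F q (X q)) p :=
  ContMDiffAt.comp (g := tangentMap 𝓘(ℝ, E) 𝓘(ℝ, E') F) (f := T% X) p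
    (F.contMDiff.contMDiff_tangentMap (m := ∞) (by simp)).contMDiffAt hX

theorem MDiffAlongAt.differential [IsManifold 𝓘(ℝ, E) ∞ M] {X : Π q : M, TangentSpace 𝓘(ℝ, E) q}
    (hX : MDiffAt (T% X) p) :
    MDiffAlongAt F (fun q ↦ differential F q (X q)) p :=
  MDifferentiableAt.comp (g := tangentMap 𝓘(ℝ, E) 𝓘(ℝ, E') F) (f := T% X) p
    ((F.contMDiff.contMDiff_tangentMap (m := ∞) (by simp)).mdifferentiableAt (by simp)) hX

theorem eventually_mem_baseSet_trivializationAt (x : N) :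
    ∀ᶠ y in 𝓝 x, y ∈ (trivializationAt E' (fun x : N ↦ TangentSpace 𝓘(ℝ, E') x) x).baseSet :=
  (trivializationAt E' (fun x : N ↦ TangentSpace 𝓘(ℝ, E') x) x).open_baseSet.mem_nhds
    (mem_baseSet_trivializationAt' x)

theorem extend_eq_symmL {x y : N} (v : TangentSpace 𝓘(ℝ, E') x)
    (hy : y ∈ (trivializationAt E' (fun x : N ↦ TangentSpace 𝓘(ℝ, E') x) x).baseSet) :
    extend E' v y = (trivializationAt E' (fun x : N ↦ TangentSpace 𝓘(ℝ, E') x) x).symmL ℝ y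
      ((trivializationAt E' (fun x : N ↦ TangentSpace 𝓘(ℝ, E') x) x).continuousLinearMapAt
        ℝ x v) := by
  rw [Trivialization.symmL_apply _ hy,
    Trivialization.continuousLinearMapAt_apply_of_mem ℝ _ (mem_baseSet_trivializationAt' x)]
  rfl

theorem eventually_extend_add {x : N} (v w : TangentSpace 𝓘(ℝ, E') x) :
    ∀ᶠ y in 𝓝 x, extend E' (v + w) y = (extend E' v + extend E' w) y := by
  filter_upwards [eventually_mem_baseSet_trivializationAt (E' := E') x] with y hy
  rw [Pi.add_apply, extend_eq_symmL _ hy, extend_eq_symmL _ hy, extend_eq_symmL _ hy, map_add,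
    map_add]

theorem eventually_extend_smul {x : N} (c : ℝ) (v : TangentSpace 𝓘(ℝ, E') x) :
    ∀ᶠ y in 𝓝 x, extend E' (c • v) y = (c • extend E' v) y := by
  filter_upwards [eventually_mem_baseSet_trivializationAt (E' := E') x] with y hy
  rw [Pi.smul_apply, extend_eq_symmL _ hy, extend_eq_symmL _ hy, map_smul, map_smul]

theorem symmL_coordAlong :
    (trivializationAt E' (fun x : N ↦ TangentSpace 𝓘(ℝ, E') x) (F p)).symmL ℝ (F p)
      (coordAlong F p V p) = V p := by
  rw [Trivialization.symmL_apply _ (mem_baseSet_trivializationAt' _)]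
  exact Trivialization.symm_apply_apply_mk _ (mem_baseSet_trivializationAt' _) _

theorem mvfderiv_congr {G : Type*} [NormedAddCommGroup G] [NormedSpace ℝ G] {g h : M → G}
    (hgh : g =ᶠ[𝓝 p] h) : d% g p = d% h p := by
  ext v
  exact congrArg (fun L : E →L[ℝ] G ↦ L v) (hgh.mfderiv_eq (I := 𝓘(ℝ, E)) (I' := 𝓘(ℝ, G)))

theorem mvfderiv_dual_comp {G : Type*} [NormedAddCommGroup G] [NormedSpace ℝ G]
    (ℓ : StrongDual ℝ G) {g : M → G} (hg : MDiffAt g p) (u : TangentSpace 𝓘(ℝ, E) p) :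
    d% (fun q ↦ ℓ (g q)) p u = ℓ (d% g p u) := by
  have h := mfderiv_comp_apply (I := 𝓘(ℝ, E)) (I' := 𝓘(ℝ, G)) (I'' := 𝓘(ℝ, ℝ)) (g := ℓ) p
    ℓ.mdifferentiableAt hg u
  rw [ℓ.mfderiv_eq] at h
  exact h

theorem eventually_sum_smul_extend_eq {ι : Type*} [Fintype ι]
    (b : Basis ι ℝ (TangentSpace 𝓘(ℝ, E') (F p))) (V : Π q : M, TangentSpace 𝓘(ℝ, E') (F q)) :
    ∀ᶠ q in 𝓝 p, ∑ i, b.coord i ((trivializationAt E' (fun x : N ↦ TangentSpace 𝓘(ℝ, E') x)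
      (F p)).symmL ℝ (F p) (coordAlong F p V q)) • extend E' (b i) (F q) = V q := by
  filter_upwards [eventually_mem_baseSet F p] with q hq
  set t := trivializationAt E' (fun x : N ↦ TangentSpace 𝓘(ℝ, E') x) (F p)
  set v := t.symmL ℝ (F p) (coordAlong F p V q)
  calc ∑ i, b.coord i v • extend E' (b i) (F q)
      = t.symmL ℝ (F q) (t.continuousLinearMapAt ℝ (F p) (∑ i, b.coord i v • b i)) := by
        simp only [extend_eq_symmL _ hq, map_sum, map_smul, t]
    _ = t.symmL ℝ (F q) (coordAlong F p V q) := by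
        simp only [Basis.coord_apply, b.sum_repr, v]
        rw [Trivialization.continuousLinearMapAt_symmL _ (mem_baseSet_trivializationAt' _)]
    _ = V q := by
        rw [t.symmL_apply hq]
        exact Trivialization.symm_apply_apply_mk t hq (V q)

theorem mdiffAlongAt_extend (w : TangentSpace 𝓘(ℝ, E') (F p)) :
    MDiffAlongAt F (fun q ↦ extend E' w (F q)) p :=
  .comp (mdifferentiableAt_extend 𝓘(ℝ, E') E' w)

theorem smoothAlongAt_extend (w : TangentSpace 𝓘(ℝ, E') (F p)) :
    SmoothAlongAt F (fun q ↦ extend E' w (F q)) p :=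
  .comp (contMDiffAt_extend 𝓘(ℝ, E') E' w)

variable [FiniteDimensional ℝ E']

/-- Near `p`, every field along `F` is a combination of restrictions of the coordinate fields
`extend E' w`; the coefficients are linear functions of its coordinates, which is how they inherit
the regularity `R` of the field. -/
theorem induction_extend_along {Q : (Π q : M, TangentSpace 𝓘(ℝ, E') (F q)) → Prop}
    {R : (M → ℝ) → Prop}
    (congr : ∀ V W, (∀ᶠ q in 𝓝 p, V q = W q) → Q V → Q W)
    (add : ∀ V W, Q V → Q W → Q (fun q ↦ V q + W q))
    (smul : ∀ f V, R f → Q V → Q (fun q ↦ f q • V q))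
    (extend : ∀ w : TangentSpace 𝓘(ℝ, E') (F p), Q (fun q ↦ extend E' w (F q)))
    (hV : ∀ ℓ : E' →L[ℝ] ℝ, R (fun q ↦ ℓ (coordAlong F p V q))) : Q V := by
  set b := finBasis ℝ (TangentSpace 𝓘(ℝ, E') (F p))
  refine congr _ _ (eventually_sum_smul_extend_eq b V) ?_
  generalize (Finset.univ : Finset (Fin _)) = s
  induction s using Finset.induction_on with
  | empty =>
    refine congr _ _ ?_ (extend 0)
    filter_upwards [eventually_mem_baseSet F p] with q hq
    simp only [Finset.sum_empty, extend_eq_symmL _ hq, map_zero]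
  | insert i s hi ih =>
    simp only [Finset.sum_insert hi]
    let t := trivializationAt E' (fun x : N ↦ TangentSpace 𝓘(ℝ, E') x) (F p)
    let ℓ : E' →L[ℝ] ℝ := (b.coord i ∘ₗ (t.symmL ℝ (F p)).toLinearMap).toContinuousLinearMap
    exact add _ _ (smul _ _ (hV ℓ) (extend (b i))) ih

theorem MDiffAlongAt.induction {Q : (Π q : M, TangentSpace 𝓘(ℝ, E') (F q)) → Prop}
    (congr : ∀ V W, MDiffAlongAt F V p → (∀ᶠ q in 𝓝 p, V q = W q) → Q V → Q W)
    (add : ∀ V W, MDiffAlongAt F V p → MDiffAlongAt F W p → Q V → Q W → Q (fun q ↦ V q + W q))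
    (smul : ∀ (f : M → ℝ) V, MDiffAt f p → MDiffAlongAt F V p → Q V → Q (fun q ↦ f q • V q))
    (extend : ∀ w : TangentSpace 𝓘(ℝ, E') (F p), Q (fun q ↦ extend E' w (F q)))
    (hV : MDiffAlongAt F V p) : Q V :=
  (induction_extend_along (Q := fun V ↦ MDiffAlongAt F V p ∧ Q V) (R := fun f ↦ MDiffAt f p)
    (fun V W h hV ↦ ⟨hV.1.congr h, congr V W hV.1 h hV.2⟩)
    (fun V W hV hW ↦ ⟨hV.1.add hW.1, add V W hV.1 hW.1 hV.2 hW.2⟩)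
    (fun f V hf hV ↦ ⟨hV.1.smul hf, smul f V hf hV.1 hV.2⟩)
    (fun w ↦ ⟨mdiffAlongAt_extend w, extend w⟩)
    (fun ℓ ↦ ℓ.mdifferentiableAt.comp p (mdiffAlongAt_iff.1 hV))).2

theorem SmoothAlongAt.induction {Q : (Π q : M, TangentSpace 𝓘(ℝ, E') (F q)) → Prop}
    (congr : ∀ V W, SmoothAlongAt F V p → (∀ᶠ q in 𝓝 p, V q = W q) → Q V → Q W)
    (add : ∀ V W, SmoothAlongAt F V p → SmoothAlongAt F W p → Q V → Q W → Q (fun q ↦ V q + W q))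
    (smul : ∀ (f : M → ℝ) V, CMDiffAt ∞ f p → SmoothAlongAt F V p → Q V → Q (fun q ↦ f q • V q))
    (extend : ∀ w : TangentSpace 𝓘(ℝ, E') (F p), Q (fun q ↦ extend E' w (F q)))
    (hV : SmoothAlongAt F V p) : Q V :=
  (induction_extend_along (Q := fun V ↦ SmoothAlongAt F V p ∧ Q V) (R := fun f ↦ CMDiffAt ∞ f p)
    (fun V W h hV ↦ ⟨hV.1.congr h, congr V W hV.1 h hV.2⟩)
    (fun V W hV hW ↦ ⟨hV.1.add hW.1, add V W hV.1 hW.1 hV.2 hW.2⟩)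
    (fun f V hf hV ↦ ⟨hV.1.smul hf, smul f V hf hV.1 hV.2⟩)
    (fun w ↦ ⟨smoothAlongAt_extend w, extend w⟩)
    (fun ℓ ↦ ℓ.contMDiff.contMDiffAt.comp p (smoothAlongAt_iff.1 hV))).2

end Along

/-! ### The covariant derivative along a map -/

section CovDerivAlong

variable {E : Type*} [NormedAddCommGroup E] [NormedSpace ℝ E]
  {M : Type*} [TopologicalSpace M] [ChartedSpace E M]
  {E' : Type*} [NormedAddCommGroup E'] [NormedSpace ℝ E'] [FiniteDimensional ℝ E']
  {N : Type*} [TopologicalSpace N] [ChartedSpace E' N] [IsManifold 𝓘(ℝ, E') ∞ N]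
  [RiemannianBundle (fun x : N ↦ TangentSpace 𝓘(ℝ, E') x)]
  [IsContMDiffRiemannianBundle 𝓘(ℝ, E') ∞ E' (fun x : N ↦ TangentSpace 𝓘(ℝ, E') x)]
  {F : C^∞⟮𝓘(ℝ, E), M; 𝓘(ℝ, E'), N⟯} {p : M}
  {V W : Π q : M, TangentSpace 𝓘(ℝ, E') (F q)} {f : M → ℝ}

theorem leviCivita_add {S T : Π x : N, TangentSpace 𝓘(ℝ, E') x} {x : N}
    (hS : MDiffAt (T% S) x) (hT : MDiffAt (T% T) x) :
    leviCivita (S + T) x = leviCivita S x + leviCivita T x :=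
  leviCivita.isCovariantDerivativeOn.add hS hT

theorem leviCivita_smul {S : Π x : N, TangentSpace 𝓘(ℝ, E') x} {g : N → ℝ} {x : N}
    (hg : MDiffAt g x) (hS : MDiffAt (T% S) x) :
    leviCivita (g • S) x = g x • leviCivita S x + (d% g x).smulRight (S x) :=
  leviCivita.isCovariantDerivativeOn.leibniz hS hg

theorem leviCivita_const_smul {S : Π x : N, TangentSpace 𝓘(ℝ, E') x} (c : ℝ) {x : N}
    (hS : MDiffAt (T% S) x) : leviCivita (c • S) x = c • leviCivita S x :=
  leviCivita.isCovariantDerivativeOn.smul_const c hS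

theorem leviCivita_congr {S T : Π x : N, TangentSpace 𝓘(ℝ, E') x} {x : N}
    (hS : MDiffAt (T% S) x) (h : ∀ᶠ y in 𝓝 x, S y = T y) : leviCivita S x = leviCivita T x := by
  have hT : MDiffAt (T% T) x := by
    refine hS.congr_of_eventuallyEq ?_
    filter_upwards [h] with y hy
    rw [hy]
  exact leviCivita.isCovariantDerivativeOn.congr_of_eventuallyEq hS hT Filter.univ_mem h

theorem leviCivita_extend_add {x : N} (v w : TangentSpace 𝓘(ℝ, E') x) :
    leviCivita (extend E' (v + w)) x = leviCivita (extend E' v) x + leviCivita (extend E' w) x := by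
  rw [leviCivita_congr (mdifferentiableAt_extend 𝓘(ℝ, E') E' (v + w)) (eventually_extend_add v w),
    leviCivita_add (mdifferentiableAt_extend 𝓘(ℝ, E') E' v)
      (mdifferentiableAt_extend 𝓘(ℝ, E') E' w)]

theorem leviCivita_extend_smul {x : N} (c : ℝ) (v : TangentSpace 𝓘(ℝ, E') x) :
    leviCivita (extend E' (c • v)) x = c • leviCivita (extend E' v) x := by
  rw [leviCivita_congr (mdifferentiableAt_extend 𝓘(ℝ, E') E' (c • v)) (eventually_extend_smul c v),
    leviCivita_const_smul c (mdifferentiableAt_extend 𝓘(ℝ, E') E' v)]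

theorem covDerivAlong_apply (V : Π q : M, TangentSpace 𝓘(ℝ, E') (F q))
    (u : TangentSpace 𝓘(ℝ, E) p) :
    covDerivAlong F V p u =
      (trivializationAt E' (fun x : N ↦ TangentSpace 𝓘(ℝ, E') x) (F p)).symmL ℝ (F p)
        (d% (coordAlong F p V) p u)
      + leviCivita (extend E' (V p)) (F p) (differential F p u) :=
  rfl

theorem covDerivAlong_congr (h : ∀ᶠ q in 𝓝 p, V q = W q) :
    covDerivAlong F V p = covDerivAlong F W p := by
  ext u
  rw [covDerivAlong_apply, covDerivAlong_apply, mvfderiv_congr (coordAlong_congr h), h.self_of_nhds]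

theorem covDerivAlong_add (hV : MDiffAlongAt F V p) (hW : MDiffAlongAt F W p) :
    covDerivAlong F (fun q ↦ V q + W q) p = covDerivAlong F V p + covDerivAlong F W p := by
  ext u
  rw [add_apply, covDerivAlong_apply, covDerivAlong_apply, covDerivAlong_apply,
    mvfderiv_congr coordAlong_add,
    mvfderiv_fun_add (mdiffAlongAt_iff.1 hV) (mdiffAlongAt_iff.1 hW), leviCivita_extend_add,
    add_apply, add_apply, map_add]
  abel

theorem covDerivAlong_smul (hf : MDiffAt f p) (hV : MDiffAlongAt F V p)
    (u : TangentSpace 𝓘(ℝ, E) p) :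
    covDerivAlong F (fun q ↦ f q • V q) p u = d% f p u • V p + f p • covDerivAlong F V p u := by
  rw [covDerivAlong_apply, covDerivAlong_apply,
    mvfderiv_congr coordAlong_smul,
    mvfderiv_fun_smul hf (mdiffAlongAt_iff.1 hV), leviCivita_extend_smul]
  simp only [add_apply, smul_apply,
    ContinuousLinearMap.smulRight_apply, map_add, map_smul]
  rw [symmL_coordAlong]
  module

theorem covDerivAlong_zero (u : TangentSpace 𝓘(ℝ, E) p) :
    covDerivAlong F (fun _ ↦ 0) p u = 0 := by
  have hzero : MDiffAlongAt F (fun _ ↦ 0) p := MDiffAlongAt.comp (S := 0)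
    ((contMDiff_zeroSection (n := ∞) ℝ
      (fun x : N ↦ TangentSpace 𝓘(ℝ, E') x)).contMDiffAt.mdifferentiableAt (by simp))
  have hadd := congrArg (· u) (covDerivAlong_add hzero hzero)
  simp only [add_zero, add_apply] at hadd
  exact left_eq_add.1 hadd

/-- The coordinates of `extend E' w` are constant, so only the connection term of the definition of
`covDerivAlong` is left. -/
theorem covDerivAlong_extend (w : TangentSpace 𝓘(ℝ, E') (F p)) (u : TangentSpace 𝓘(ℝ, E) p) :
    covDerivAlong F (fun q ↦ extend E' w (F q)) p u =
      leviCivita (extend E' w) (F p) (differential F p u) := by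
  have hconst : coordAlong F p (fun q ↦ extend E' w (F q)) =ᶠ[𝓝 p]
      fun _ ↦ (trivializationAt E' (fun x : N ↦ TangentSpace 𝓘(ℝ, E') x) (F p) ⟨F p, w⟩).2 :=
    (eventually_mem_baseSet F p).mono fun q hq ↦ by
      simp only [coordAlong, extend, Trivialization.apply_mk_symm _ hq]
  rw [covDerivAlong_apply, mvfderiv_congr hconst, mvfderiv_const, extend_apply_self]
  simp only [zero_apply, map_zero, zero_add]

theorem covDerivAlong_id {S : Π x : N, TangentSpace 𝓘(ℝ, E') x} {x : N} (hS : MDiffAt (T% S) x)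
    (u : TangentSpace 𝓘(ℝ, E') x) :
    covDerivAlong (.id : C^∞⟮𝓘(ℝ, E'), N; 𝓘(ℝ, E'), N⟯) S x u = leviCivita S x u := by
  refine MDiffAlongAt.induction (F := (.id : C^∞⟮𝓘(ℝ, E'), N; 𝓘(ℝ, E'), N⟯))
    (Q := fun S ↦ covDerivAlong .id S x u = leviCivita S x u) ?_ ?_ ?_ ?_ hS
  · intro V W hV hVW h
    rw [← covDerivAlong_congr hVW, h, leviCivita_congr hV hVW]
  · intro V W hV hW h₁ h₂
    rw [covDerivAlong_add hV hW, add_apply, h₁, h₂]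
    exact congrArg (fun L : E' →L[ℝ] E' ↦ L u) (leviCivita_add hV hW).symm
  · intro f V hf hV h
    rw [covDerivAlong_smul hf hV, h, add_comm]
    exact congrArg (fun L : E' →L[ℝ] E' ↦ L u) (leviCivita_smul hf hV).symm
  · intro w
    exact (covDerivAlong_extend _ _).trans
      (congrArg (leviCivita (extend E' w) x) (differential_id x u))

theorem covDerivAlong_comp {S : Π x : N, TangentSpace 𝓘(ℝ, E') x} (hS : MDiffAt (T% S) (F p))
    (u : TangentSpace 𝓘(ℝ, E) p) :
    covDerivAlong F (fun q ↦ S (F q)) p u = leviCivita S (F p) (differential F p u) := by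
  let idN : C^∞⟮𝓘(ℝ, E'), N; 𝓘(ℝ, E'), N⟯ := .id
  have hcoordS : MDiffAt (coordAlong idN (F p) S) (F p) := (mdiffAlongAt_iff (F := idN)).1 hS
  have hcoord : d% (coordAlong F p (fun q ↦ S (F q))) p u =
      d% (coordAlong idN (F p) S) (F p) (differential F p u) :=
    mfderiv_comp_apply (f := F) p hcoordS (F.contMDiff.mdifferentiableAt (by simp)) u
  rw [← covDerivAlong_id hS, covDerivAlong_apply, hcoord]
  refine .trans ?_ (covDerivAlong_apply (F := idN) S (differential F p u)).symm
  rw [differential_id]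
  rfl

end CovDerivAlong

/-! ### Smoothness of the Levi-Civita connection -/

section ContinuousLinearMap

variable {EM : Type*} [NormedAddCommGroup EM] [NormedSpace ℝ EM]
  {HM : Type*} [TopologicalSpace HM] {IM : ModelWithCorners ℝ EM HM}
  {M : Type*} [TopologicalSpace M] [ChartedSpace HM M]
  {G : Type*} [NormedAddCommGroup G] [NormedSpace ℝ G]
  {G' : Type*} [NormedAddCommGroup G'] [NormedSpace ℝ G']
  {n : WithTop ℕ∞} {A : M → G →L[ℝ] G'} {x : M}

theorem contMDiffAt_clm_of_apply [FiniteDimensional ℝ G]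
    (hA : ∀ v, CMDiffAt n (fun y ↦ A y v) x) : CMDiffAt n A x := by
  let b := finBasis ℝ G
  let coord (i) : StrongDual ℝ G := (b.coord i).toContinuousLinearMap
  have hsum : A = fun y ↦ ∑ i, ContinuousLinearMap.smulRightL ℝ G G' (coord i) (A y (b i)) := by
    ext y v
    conv_lhs => rw [← b.sum_repr v, map_sum]
    simp [coord, sum_apply]
  rw [hsum]
  exact ContMDiffAt.sum fun i _ ↦
    (ContinuousLinearMap.smulRightL ℝ G G' (coord i)).contMDiff.contMDiffAt.comp x (hA (b i))

theorem contMDiffAt_of_clm_apply [CompleteSpace G] {s : M → G} (hA : CMDiffAt n A x)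
    (hAx : (A x).IsInvertible) (hAs : CMDiffAt n (fun y ↦ A y (s y)) x) : CMDiffAt n s x := by
  obtain ⟨e, he⟩ := hAx
  have hinverse : ContDiffAt ℝ n ContinuousLinearMap.inverse (A x) :=
    he ▸ contDiffAt_map_inverse e
  have hev : ∀ᶠ y in 𝓝 x, ∃ e' : G ≃L[ℝ] G', e' = A y :=
    hA.continuousAt.eventually (by rw [← he]; exact e.nhds)
  refine ((hinverse.contMDiffAt.comp x hA).clm_apply hAs).congr_of_eventuallyEq ?_
  filter_upwards [hev] with y ⟨e', he'⟩
  simp [← he']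

end ContinuousLinearMap

section RiemannianBundles

variable {EB : Type*} [NormedAddCommGroup EB] [NormedSpace ℝ EB]
  {HB : Type*} [TopologicalSpace HB] {IB : ModelWithCorners ℝ EB HB}
  {B : Type*} [TopologicalSpace B] [ChartedSpace HB B]
  {F : Type*} [NormedAddCommGroup F] [NormedSpace ℝ F] {V : B → Type*}
  [TopologicalSpace (TotalSpace F V)] [∀ b, TopologicalSpace (V b)]
  [∀ b, AddCommGroup (V b)] [∀ b, Module ℝ (V b)]
  [∀ b, IsTopologicalAddGroup (V b)] [∀ b, ContinuousConstSMul ℝ (V b)]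
  [FiberBundle F V] [VectorBundle ℝ F V] [RiemannianBundle V]
  {EM : Type*} [NormedAddCommGroup EM] [NormedSpace ℝ EM]
  {HM : Type*} [TopologicalSpace HM] {IM : ModelWithCorners ℝ EM HM}
  {M : Type*} [TopologicalSpace M] [ChartedSpace HM M]
  {b : M → B} {v w : Π x, V (b x)} {x : M}

theorem contMDiffAt_inner_bundle {n : WithTop ℕ∞} [IsContMDiffRiemannianBundle IB n F V]
    (hv : CMDiffAt n (fun m ↦ (v m : TotalSpace F V)) x)
    (hw : CMDiffAt n (fun m ↦ (w m : TotalSpace F V)) x) :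
    CMDiffAt n (fun m ↦ inner ℝ (v m) (w m)) x :=
  hv.inner_bundle hw

theorem mdifferentiableAt_inner_bundle_comp [IsContMDiffRiemannianBundle IB 1 F V]
    (hv : MDiffAt (fun m ↦ (v m : TotalSpace F V)) x)
    (hw : MDiffAt (fun m ↦ (w m : TotalSpace F V)) x) :
    MDiffAt (fun m ↦ inner ℝ (v m) (w m)) x :=
  hv.inner_bundle hw

end RiemannianBundles

section Smoothness

variable {E : Type*} [NormedAddCommGroup E] [NormedSpace ℝ E]
  {M : Type*} [TopologicalSpace M] [ChartedSpace E M] [IsManifold 𝓘(ℝ, E) ∞ M]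
  {X Y : Π q : M, TangentSpace 𝓘(ℝ, E) q} {x : M}

theorem eventually_mdifferentiableAt_section (hX : CMDiffAt ∞ (T% X) x) :
    ∀ᶠ y in 𝓝 x, MDiffAt (T% X) y :=
  eventually_mdifferentiableAt (ContMDiffAt.of_le hX (by simp))

theorem contMDiffAt_mvfderiv_apply {G : Type*} [NormedAddCommGroup G] [NormedSpace ℝ G] {f : M → G}
    (hf : CMDiffAt ∞ f x) (hX : CMDiffAt ∞ (T% X) x) : CMDiffAt ∞ (fun y ↦ d% f y (X y)) x := by
  have h := ContMDiffAt.clm_apply_of_inCoordinates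
    (F₁ := E) (E₁ := TangentSpace 𝓘(ℝ, E)) (F₂ := G) (E₂ := TangentSpace 𝓘(ℝ, G))
    (b₁ := id) (b₂ := f) (hf.mfderiv_const (m := ∞) (by simp)) hX hf
  rw [contMDiffAt_totalSpace] at h
  refine h.2.congr_of_eventuallyEq (.of_forall fun q ↦ ?_)
  simp only [trivializationAt_model_space_apply]
  rfl

variable [FiniteDimensional ℝ E]

theorem contMDiffAt_mlieBracket (hX : CMDiffAt ∞ (T% X) x) (hY : CMDiffAt ∞ (T% Y) x) :
    CMDiffAt ∞ (T% (mlieBracket 𝓘(ℝ, E) X Y)) x :=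
  have : IsManifold 𝓘(ℝ, E) (minSmoothness ℝ 2) M :=
    .of_le (n := ∞) (by simpa using ENat.LEInfty.out)
  have : IsManifold 𝓘(ℝ, E) (((⊤ : ℕ∞) : WithTop ℕ∞) + 1) M := .of_le (n := ∞) (by simp)
  ContMDiffAt.mlieBracket_vectorField (m := ⊤) (n := ⊤) hX hY (by simp)

variable [RiemannianBundle (fun x : M ↦ TangentSpace 𝓘(ℝ, E) x)]
  [IsContMDiffRiemannianBundle 𝓘(ℝ, E) ∞ E (fun x : M ↦ TangentSpace 𝓘(ℝ, E) x)]

/-- The inner products with the extensions of a basis of `T_x M` determine the coordinates of the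
field through a matrix that depends smoothly on the point and is invertible at `x`. -/
theorem contMDiffAt_of_inner
    (h : ∀ Y : Π y : M, TangentSpace 𝓘(ℝ, E) y, CMDiffAt ∞ (T% Y) x →
      CMDiffAt ∞ (fun y ↦ inner ℝ (Y y) (X y)) x) : CMDiffAt ∞ (T% X) x := by
  set t := trivializationAt E (fun x : M ↦ TangentSpace 𝓘(ℝ, E) x) x
  have hx : x ∈ t.baseSet := mem_baseSet_trivializationAt' x
  have hbase : ∀ᶠ y in 𝓝 x, y ∈ t.baseSet := eventually_mem_baseSet_trivializationAt x
  let b : Basis (Fin (finrank ℝ E)) ℝ (TangentSpace 𝓘(ℝ, E) x) := finBasis ℝ E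
  have hb (i) : CMDiffAt ∞ (T% (extend E (b i))) x := contMDiffAt_extend 𝓘(ℝ, E) E (b i)
  let A (y : M) : E →L[ℝ] (Fin (finrank ℝ E) → ℝ) :=
    .pi fun i ↦ (innerSL ℝ (extend E (b i) y)).comp (t.symmL ℝ y)
  have hA : CMDiffAt ∞ A x := by
    refine contMDiffAt_clm_of_apply fun v ↦ contMDiffAt_pi_space.2 fun i ↦ ?_
    have hv := contMDiffAt_extend (k := ∞) 𝓘(ℝ, E) E (t.symmL ℝ x v)
    refine (contMDiffAt_inner_bundle (hb i) hv).congr_of_eventuallyEq (hbase.mono fun y hy ↦ ?_)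
    change inner ℝ _ (t.symmL ℝ y v) = inner ℝ _ (extend E (t.symmL ℝ x v) y)
    rw [extend_eq_symmL (t.symmL ℝ x v) hy, t.continuousLinearMapAt_symmL hx]
  have hinj : Function.Injective (A x) := by
    refine (injective_iff_map_eq_zero _).2 fun v hv ↦ ?_
    have hv' : t.symmL ℝ x v = 0 := InnerProductSpace.ext_inner_left_basis b fun i ↦ by
      simpa [A, extend_apply_self] using congrFun hv i
    rw [← t.continuousLinearMapAt_symmL (R := ℝ) hx v, hv', map_zero]
  have hAx : (A x).IsInvertible :=
    ⟨(LinearEquiv.ofInjectiveOfFinrankEq (A x).toLinearMap hinj (by simp)).toContinuousLinearEquiv,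
      rfl⟩
  refine (contMDiffAt_section _).2 (contMDiffAt_of_clm_apply hA hAx ?_)
  refine (contMDiffAt_pi_space.2 fun i ↦ h _ (hb i)).congr_of_eventuallyEq
    (hbase.mono fun y hy ↦ funext fun i ↦ ?_)
  change inner ℝ (extend E (b i) y) (t.symmL ℝ y (t ⟨y, X y⟩).2) = _
  rw [t.symmL_apply hy, t.symm_apply_apply_mk hy]

theorem contMDiffAt_leviCivita (hX : CMDiffAt ∞ (T% X) x) (hY : CMDiffAt ∞ (T% Y) x) :
    CMDiffAt ∞ (T% (fun y ↦ leviCivita Y y (X y))) x := by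
  refine contMDiffAt_of_inner fun Z hZ ↦ ?_
  have hinner {X Y : Π x : M, TangentSpace 𝓘(ℝ, E) x} (hX : CMDiffAt ∞ (T% X) x)
      (hY : CMDiffAt ∞ (T% Y) x) : CMDiffAt ∞ (fun y ↦ inner ℝ (X y) (Y y)) x :=
    contMDiffAt_inner_bundle hX hY
  have hkoszul : CMDiffAt ∞ (koszul Y X Z) x :=
    contMDiffAt_const.mul <|
      (((((contMDiffAt_mvfderiv_apply (hinner hY hZ) hX).add
        (contMDiffAt_mvfderiv_apply (hinner hX hZ) hY)).sub
        (contMDiffAt_mvfderiv_apply (hinner hX hY) hZ)).add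
        (hinner (contMDiffAt_mlieBracket hX hY) hZ)).sub
        (hinner (contMDiffAt_mlieBracket hX hZ) hY)).sub
        (hinner (contMDiffAt_mlieBracket hY hZ) hX)
  refine hkoszul.congr_of_eventuallyEq ?_
  filter_upwards [eventually_mdifferentiableAt_section hX,
    eventually_mdifferentiableAt_section hY, eventually_mdifferentiableAt_section hZ]
    with y hXy hYy hZy
  rw [real_inner_comm]
  exact inner_leviCivitaFun hXy hYy hZy

end Smoothness

section LieBracket

variable {E : Type*} [NormedAddCommGroup E] [NormedSpace ℝ E] [FiniteDimensional ℝ E]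
  {M : Type*} [TopologicalSpace M] [ChartedSpace E M] [IsManifold 𝓘(ℝ, E) ∞ M]
  {X Y Z : Π q : M, TangentSpace 𝓘(ℝ, E) q} {p : M}

theorem mlieBracket_mlieBracket_smul {g : M → ℝ} (hY : CMDiffAt ∞ (T% Y) p)
    (hZ : CMDiffAt ∞ (T% Z) p) (hg : CMDiffAt ∞ g p) :
    mlieBracket 𝓘(ℝ, E) X (mlieBracket 𝓘(ℝ, E) Y (g • Z)) p =
      d% (fun q ↦ d% g q (Y q)) p (X p) • Z p + d% g p (Y p) • mlieBracket 𝓘(ℝ, E) X Z p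
      + (d% g p (X p) • mlieBracket 𝓘(ℝ, E) Y Z p
        + g p • mlieBracket 𝓘(ℝ, E) X (mlieBracket 𝓘(ℝ, E) Y Z) p) := by
  have : IsManifold 𝓘(ℝ, E) (minSmoothness ℝ 2) M :=
    .of_le (n := ∞) (by simpa using ENat.LEInfty.out)
  have hgd : MDiffAt g p := hg.mdifferentiableAt (by simp)
  have hZd : MDiffAt (T% Z) p := ContMDiffAt.mdifferentiableAt hZ (by simp)
  have hdg : MDiffAt (fun q ↦ d% g q (Y q)) p :=
    (contMDiffAt_mvfderiv_apply hg hY).mdifferentiableAt (by simp)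
  have hYZ : MDiffAt (T% (mlieBracket 𝓘(ℝ, E) Y Z)) p :=
    ContMDiffAt.mdifferentiableAt (contMDiffAt_mlieBracket hY hZ) (by simp)
  have hinner : mlieBracket 𝓘(ℝ, E) Y (g • Z) =ᶠ[𝓝 p]
      (fun q ↦ d% g q (Y q)) • Z + g • mlieBracket 𝓘(ℝ, E) Y Z := by
    filter_upwards [eventually_mdifferentiableAt_section hZ,
      eventually_mdifferentiableAt (hg.of_le (by simp))] with q hZq hgq
    exact mlieBracket_smul_right hgq hZq
  rw [Filter.EventuallyEq.mlieBracket_vectorField_eq (V₁ := X) (V := X) .rfl hinner,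
    mlieBracket_add_right (hdg.smul_section hZd) (hgd.smul_section hYZ),
    mlieBracket_smul_right hdg hZd, mlieBracket_smul_right hgd hYZ]

theorem mvfderiv_mlieBracket {g : M → ℝ} (hX : CMDiffAt ∞ (T% X) p) (hY : CMDiffAt ∞ (T% Y) p)
    (hg : CMDiffAt ∞ g p) :
    d% g p (mlieBracket 𝓘(ℝ, E) X Y p) =
      d% (fun q ↦ d% g q (Y q)) p (X p) - d% (fun q ↦ d% g q (X q)) p (Y p) := by
  have : IsManifold 𝓘(ℝ, E) (minSmoothness ℝ 3) M :=
    .of_le (n := ∞) (by simpa using ENat.LEInfty.out)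
  have hle : minSmoothness ℝ 2 ≤ (∞ : WithTop ℕ∞) := by simpa using ENat.LEInfty.out
  -- The Jacobi identities for `X`, `Y`, `Z` and `X`, `Y`, `g • Z` differ by the claim times `Z`.
  have hjacobi (v : TangentSpace 𝓘(ℝ, E) p) :
      (d% (fun q ↦ d% g q (Y q)) p (X p) - d% (fun q ↦ d% g q (X q)) p (Y p)
        - d% g p (mlieBracket 𝓘(ℝ, E) X Y p)) • v = 0 := by
    have hZ : CMDiffAt ∞ (T% (extend E v)) p := contMDiffAt_extend 𝓘(ℝ, E) E v
    have hgZ : CMDiffAt ∞ (T% (g • extend E v)) p := hg.smul_section hZ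
    have h := leibniz_identity_mlieBracket_apply (hX.of_le hle) (hY.of_le hle) (hgZ.of_le hle)
    rw [mlieBracket_mlieBracket_smul hY hZ hg, mlieBracket_mlieBracket_smul hX hZ hg,
      mlieBracket_smul_right (hg.mdifferentiableAt (by simp))
        (ContMDiffAt.mdifferentiableAt hZ (by simp)),
      leibniz_identity_mlieBracket_apply (hX.of_le hle) (hY.of_le hle) (hZ.of_le hle),
      extend_apply_self, ← sub_eq_zero] at h
    refine .trans ?_ h
    module
  rcases subsingleton_or_nontrivial (TangentSpace 𝓘(ℝ, E) p) with _ | _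
  · simp only [Subsingleton.elim _ (0 : TangentSpace 𝓘(ℝ, E) p), map_zero, sub_zero]
  · obtain ⟨v, hv⟩ := exists_ne (0 : TangentSpace 𝓘(ℝ, E) p)
    exact (sub_eq_zero.1 ((smul_eq_zero.1 (hjacobi v)).resolve_right hv)).symm

theorem mvfderiv_mlieBracket_vector {G : Type*} [NormedAddCommGroup G] [NormedSpace ℝ G] {g : M → G}
    (hX : CMDiffAt ∞ (T% X) p) (hY : CMDiffAt ∞ (T% Y) p) (hg : CMDiffAt ∞ g p) :
    d% g p (mlieBracket 𝓘(ℝ, E) X Y p) =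
      d% (fun q ↦ d% g q (Y q)) p (X p) - d% (fun q ↦ d% g q (X q)) p (Y p) := by
  refine (SeparatingDual.eq_iff_forall_dual_eq (R := ℝ)).2 fun ℓ ↦ ?_
  have hderiv {A : Π q : M, TangentSpace 𝓘(ℝ, E) q} (hA : CMDiffAt ∞ (T% A) p)
      (u : TangentSpace 𝓘(ℝ, E) p) :
      d% (fun q ↦ d% (fun q ↦ ℓ (g q)) q (A q)) p u = ℓ (d% (fun q ↦ d% g q (A q)) p u) := by
    rw [← mvfderiv_dual_comp ℓ ((contMDiffAt_mvfderiv_apply hg hA).mdifferentiableAt (by simp))]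
    exact congrArg (· u) <| mvfderiv_congr <|
      (eventually_mdifferentiableAt (hg.of_le (by simp))).mono fun q hq ↦
        mvfderiv_dual_comp ℓ hq (A q)
  rw [map_sub, ← hderiv hY, ← hderiv hX, ← mvfderiv_dual_comp ℓ (hg.mdifferentiableAt (by simp))]
  exact mvfderiv_mlieBracket hX hY (ℓ.contMDiff.contMDiffAt.comp p hg)

end LieBracket

section CovDerivAlong

variable {E : Type*} [NormedAddCommGroup E] [NormedSpace ℝ E]
  {M : Type*} [TopologicalSpace M] [ChartedSpace E M]
  {E' : Type*} [NormedAddCommGroup E'] [NormedSpace ℝ E']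
  {N : Type*} [TopologicalSpace N] [ChartedSpace E' N] [IsManifold 𝓘(ℝ, E') ∞ N]
  [RiemannianBundle (fun x : N ↦ TangentSpace 𝓘(ℝ, E') x)]
  [IsContMDiffRiemannianBundle 𝓘(ℝ, E') ∞ E' (fun x : N ↦ TangentSpace 𝓘(ℝ, E') x)]
  {F : C^∞⟮𝓘(ℝ, E), M; 𝓘(ℝ, E'), N⟯} {p : M}
  {V W : Π q : M, TangentSpace 𝓘(ℝ, E') (F q)}

theorem SmoothAlongAt.inner (hV : SmoothAlongAt F V p) (hW : SmoothAlongAt F W p) :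
    CMDiffAt ∞ (fun q ↦ inner ℝ (V q) (W q)) p :=
  contMDiffAt_inner_bundle hV hW

theorem MDiffAlongAt.inner (hV : MDiffAlongAt F V p) (hW : MDiffAlongAt F W p) :
    MDiffAt (fun q ↦ inner ℝ (V q) (W q)) p :=
  mdifferentiableAt_inner_bundle_comp hV hW

variable [FiniteDimensional ℝ E']

theorem mvfderiv_inner_along_of_extend {u : TangentSpace 𝓘(ℝ, E) p}
    (h : ∀ w : TangentSpace 𝓘(ℝ, E') (F p),
      d% (fun q ↦ inner ℝ (extend E' w (F q)) (W q)) p u =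
        inner ℝ (covDerivAlong F (fun q ↦ extend E' w (F q)) p u) (W p)
          + inner ℝ (extend E' w (F p)) (covDerivAlong F W p u))
    (hV : MDiffAlongAt F V p) (hW : MDiffAlongAt F W p) :
    d% (fun q ↦ inner ℝ (V q) (W q)) p u =
      inner ℝ (covDerivAlong F V p u) (W p) + inner ℝ (V p) (covDerivAlong F W p u) := by
  refine hV.induction (Q := fun V ↦ d% (fun q ↦ inner ℝ (V q) (W q)) p u =
      inner ℝ (covDerivAlong F V p u) (W p) + inner ℝ (V p) (covDerivAlong F W p u)) ?_ ?_ ?_ h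
  · intro V V' _ hVV' hV
    have hinner : d% (fun q ↦ inner ℝ (V' q) (W q)) p = d% (fun q ↦ inner ℝ (V q) (W q)) p :=
      mvfderiv_congr (hVV'.mono fun q hq ↦ by simp only [hq])
    rw [hinner, ← covDerivAlong_congr hVV', ← hVV'.self_of_nhds, hV]
  · intro V V' hV hV' h₁ h₂
    simp only [inner_add_left]
    rw [mvfderiv_fun_add (hV.inner hW) (hV'.inner hW), covDerivAlong_add hV hV', add_apply,
      add_apply, inner_add_left, h₁, h₂]
    ring
  · intro f V hf hV h₁
    simp only [real_inner_smul_left]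
    rw [mvfderiv_fun_mul hf (hV.inner hW), covDerivAlong_smul hf hV, inner_add_left,
      real_inner_smul_left, real_inner_smul_left, add_apply, smul_apply, smul_apply, h₁]
    simp only [smul_eq_mul]
    ring

theorem mvfderiv_inner_comp {S T : Π x : N, TangentSpace 𝓘(ℝ, E') x} (hS : MDiffAt (T% S) (F p))
    (hT : MDiffAt (T% T) (F p)) (u : TangentSpace 𝓘(ℝ, E) p) :
    d% (fun q ↦ inner ℝ (S (F q)) (T (F q))) p u =
      inner ℝ (covDerivAlong F (fun q ↦ S (F q)) p u) (T (F p))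
        + inner ℝ (S (F p)) (covDerivAlong F (fun q ↦ T (F q)) p u) := by
  have hchain : d% (fun q ↦ inner ℝ (S (F q)) (T (F q))) p u
      = d% (fun y ↦ inner ℝ (S y) (T y)) (F p) (differential F p u) :=
    mfderiv_comp_apply (g := fun y ↦ inner ℝ (S y) (T y)) p (mdifferentiableAt_inner hS hT)
      (F.contMDiff.mdifferentiableAt (by simp)) u
  have hmetric := leviCivita_metric
    (mdifferentiableAt_extend 𝓘(ℝ, E') E' (differential F p u)) hS hT
  rw [extend_apply_self] at hmetric
  rw [hchain, hmetric, covDerivAlong_comp hS, covDerivAlong_comp hT]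

theorem mvfderiv_inner_along (hV : MDiffAlongAt F V p) (hW : MDiffAlongAt F W p)
    (u : TangentSpace 𝓘(ℝ, E) p) :
    d% (fun q ↦ inner ℝ (V q) (W q)) p u =
      inner ℝ (covDerivAlong F V p u) (W p) + inner ℝ (V p) (covDerivAlong F W p u) := by
  refine mvfderiv_inner_along_of_extend (fun w ↦ ?_) hV hW
  have h := mvfderiv_inner_along_of_extend (u := u) (fun w' ↦ mvfderiv_inner_comp
    (mdifferentiableAt_extend 𝓘(ℝ, E') E' w') (mdifferentiableAt_extend 𝓘(ℝ, E') E' w) u)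
    hW (mdiffAlongAt_extend w)
  simp only [real_inner_comm _ (W _), real_inner_comm _ (covDerivAlong F W p u)] at h
  rw [h, add_comm]

variable {J : Π x : N, TangentSpace 𝓘(ℝ, E') x →L[ℝ] TangentSpace 𝓘(ℝ, E') x}

theorem SmoothAlongAt.kaehler (hJ : IsKaehler J) (hV : SmoothAlongAt F V p) :
    SmoothAlongAt F (fun q ↦ J (F q) (V q)) p :=
  ContMDiffAt.clm_bundle_apply (hJ.smooth.contMDiffAt.comp p F.contMDiff.contMDiffAt) hV

theorem MDiffAlongAt.kaehler (hJ : IsKaehler J) (hV : MDiffAlongAt F V p) :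
    MDiffAlongAt F (fun q ↦ J (F q) (V q)) p :=
  MDifferentiableAt.clm_bundle_apply
    ((hJ.smooth.contMDiffAt.mdifferentiableAt (by simp)).comp p
      (F.contMDiff.mdifferentiableAt (by simp))) hV

theorem contMDiffAt_kaehler (hJ : IsKaehler J) {S : Π x : N, TangentSpace 𝓘(ℝ, E') x} {x : N}
    (hS : CMDiffAt ∞ (T% S) x) : CMDiffAt ∞ (T% (fun y ↦ J y (S y))) x :=
  ContMDiffAt.clm_bundle_apply (b := id) hJ.smooth.contMDiffAt hS

theorem covDerivAlong_kaehler (hJ : IsKaehler J) (hV : MDiffAlongAt F V p)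
    (u : TangentSpace 𝓘(ℝ, E) p) :
    covDerivAlong F (fun q ↦ J (F q) (V q)) p u = J (F p) (covDerivAlong F V p u) := by
  refine hV.induction (Q := fun V ↦ covDerivAlong F (fun q ↦ J (F q) (V q)) p u
    = J (F p) (covDerivAlong F V p u)) ?_ ?_ ?_ ?_
  · intro V V' _ hVV' hV
    have hJV : ∀ᶠ q in 𝓝 p, J (F q) (V q) = J (F q) (V' q) := hVV'.mono fun q hq ↦ by rw [hq]
    rw [← covDerivAlong_congr hVV', ← covDerivAlong_congr hJV, hV]
  · intro V V' hV hV' h₁ h₂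
    simp only [map_add]
    rw [covDerivAlong_add (hV.kaehler hJ) (hV'.kaehler hJ), covDerivAlong_add hV hV', add_apply,
      add_apply, h₁, h₂, map_add]
  · intro f V hf hV h₁
    simp only [map_smul]
    rw [covDerivAlong_smul hf (hV.kaehler hJ), covDerivAlong_smul hf hV, h₁, map_add, map_smul,
      map_smul]
  · intro w
    have hw : CMDiffAt ∞ (T% (extend E' w)) (F p) := contMDiffAt_extend 𝓘(ℝ, E') E' w
    rw [covDerivAlong_comp (S := fun y ↦ J y (extend E' w y))
      (ContMDiffAt.mdifferentiableAt (contMDiffAt_kaehler hJ hw) (by simp)),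
      covDerivAlong_comp (ContMDiffAt.mdifferentiableAt hw (by simp)), hJ.parallel _ _ _ hw]

theorem SmoothAlongAt.leviCivita {S : Π x : N, TangentSpace 𝓘(ℝ, E') x}
    (hS : CMDiffAt ∞ (T% S) (F p)) (hV : SmoothAlongAt F V p) :
    SmoothAlongAt F (fun q ↦ leviCivita S (F q) (V q)) p := by
  refine hV.induction
    (Q := fun V ↦ SmoothAlongAt F (fun q ↦ TotallyReal.leviCivita S (F q) (V q)) p) ?_ ?_ ?_ ?_
  · intro V W _ hVW hV
    exact hV.congr (hVW.mono fun q hq ↦ by rw [hq])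
  · intro V W _ _ hV hW
    simpa only [map_add] using hV.add hW
  · intro f V hf _ hV
    simpa only [map_smul] using hV.smul hf
  · intro w
    exact .comp (contMDiffAt_leviCivita (contMDiffAt_extend 𝓘(ℝ, E') E' w) hS)

variable [IsManifold 𝓘(ℝ, E) ∞ M] {X Y : Π q : M, TangentSpace 𝓘(ℝ, E) q}

theorem SmoothAlongAt.covDerivAlong (hX : CMDiffAt ∞ (T% X) p) (hV : SmoothAlongAt F V p) :
    SmoothAlongAt F (fun q ↦ covDerivAlong F V q (X q)) p := by
  refine hV.induction
    (Q := fun V ↦ SmoothAlongAt F (fun q ↦ TotallyReal.covDerivAlong F V q (X q)) p) ?_ ?_ ?_ ?_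
  · intro V W _ hVW hV
    exact hV.congr (hVW.eventually_nhds.mono fun q hq ↦ by rw [covDerivAlong_congr hq])
  · intro V W hV hW h₁ h₂
    refine (h₁.add h₂).congr ?_
    filter_upwards [hV.eventually_mdiffAlongAt, hW.eventually_mdiffAlongAt] with q hVq hWq
    rw [covDerivAlong_add hVq hWq, add_apply]
  · intro f V hf hV h₁
    refine ((hV.smul (contMDiffAt_mvfderiv_apply hf hX)).add (h₁.smul hf)).congr ?_
    filter_upwards [hV.eventually_mdiffAlongAt,
      eventually_mdifferentiableAt (hf.of_le (by simp))] with q hVq hfq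
    rw [covDerivAlong_smul hfq hVq]
  · intro w
    have hw : CMDiffAt ∞ (T% (extend E' w)) (F p) := contMDiffAt_extend 𝓘(ℝ, E') E' w
    refine (SmoothAlongAt.leviCivita hw (.differential hX)).congr ?_
    filter_upwards [F.contMDiff.continuous.continuousAt.eventually
      (eventually_mdifferentiableAt_section hw)] with q hq
    exact (covDerivAlong_comp hq _).symm

end CovDerivAlong

section Torsion

variable {E : Type*} [NormedAddCommGroup E] [NormedSpace ℝ E]
  {M : Type*} [TopologicalSpace M] [ChartedSpace E M]
  {E' : Type*} [NormedAddCommGroup E'] [NormedSpace ℝ E']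
  {N : Type*} [TopologicalSpace N] [ChartedSpace E' N] [IsManifold 𝓘(ℝ, E') ∞ N]

theorem eventually_trivializationAt_eq_mvfderiv (x : N) :
    ∀ᶠ y in 𝓝 x, ∀ v : TangentSpace 𝓘(ℝ, E') y,
      (trivializationAt E' (fun x : N ↦ TangentSpace 𝓘(ℝ, E') x) x ⟨y, v⟩).2
        = d% (extChartAt 𝓘(ℝ, E') x) y v := by
  filter_upwards [eventually_mem_baseSet_trivializationAt (E' := E') x] with y hy v
  rw [← Trivialization.continuousLinearMapAt_apply_of_mem ℝ _ hy]
  exact congrArg (fun L ↦ L v)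
    (TangentBundle.continuousLinearMapAt_trivializationAt (I := 𝓘(ℝ, E')) (x₀ := x) (x := y) hy)

theorem eventually_coordAlong_differential (F : C^∞⟮𝓘(ℝ, E), M; 𝓘(ℝ, E'), N⟯) (p : M)
    (X : Π q : M, TangentSpace 𝓘(ℝ, E) q) :
    ∀ᶠ q in 𝓝 p, coordAlong F p (fun q ↦ differential F q (X q)) q
      = d% (fun q ↦ extChartAt 𝓘(ℝ, E') (F p) (F q)) q (X q) := by
  have hF := F.contMDiff.continuous.continuousAt (x := p)
  have hchart : CMDiffAt 1 (extChartAt 𝓘(ℝ, E') (F p)) (F p) :=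
    (contMDiffAt_extChartAt (n := ∞)).of_le (by simp)
  filter_upwards [hF.eventually (eventually_trivializationAt_eq_mvfderiv (E' := E') (F p)),
    hF.eventually (eventually_mdifferentiableAt hchart)] with q hq hq'
  exact (hq _).trans
    (mfderiv_comp_apply q hq' (F.contMDiff.mdifferentiableAt (by simp)) (X q)).symm

theorem eventually_contMDiffAt_extend {x : N} (w : TangentSpace 𝓘(ℝ, E') x) :
    ∀ᶠ y in 𝓝 x, CMDiffAt ∞ (T% (extend E' w)) y := by
  obtain ⟨s, hs, hw⟩ := exists_contMDiffOn_extend (k := ∞) 𝓘(ℝ, E') E' w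
  exact (eventually_mem_nhds_iff.2 hs).mono fun _ hy ↦ hw.contMDiffAt hy

theorem eventually_mvfderiv_extChartAt_extend {x : N} (w : TangentSpace 𝓘(ℝ, E') x) :
    ∀ᶠ y in 𝓝 x, d% (extChartAt 𝓘(ℝ, E') x) y (extend E' w y)
      = (trivializationAt E' (fun x : N ↦ TangentSpace 𝓘(ℝ, E') x) x ⟨x, w⟩).2 := by
  filter_upwards [eventually_trivializationAt_eq_mvfderiv (E' := E') x,
    eventually_mem_baseSet_trivializationAt (E' := E') x] with y hy hyt
  set t := trivializationAt E' (fun x : N ↦ TangentSpace 𝓘(ℝ, E') x) x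
  rw [← hy]
  change (t ⟨y, t.symm y (t ⟨x, w⟩).2⟩).2 = _
  rw [t.apply_mk_symm hyt]

variable [FiniteDimensional ℝ E']

theorem eventually_mlieBracket_extend {x : N} (v w : TangentSpace 𝓘(ℝ, E') x) :
    ∀ᶠ y in 𝓝 x, mlieBracket 𝓘(ℝ, E') (extend E' v) (extend E' w) y = 0 := by
  filter_upwards [eventually_contMDiffAt_extend v, eventually_contMDiffAt_extend w,
    (eventually_mvfderiv_extChartAt_extend v).eventually_nhds,
    (eventually_mvfderiv_extChartAt_extend w).eventually_nhds,
    eventually_trivializationAt_eq_mvfderiv (E' := E') x,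
    eventually_mem_baseSet_trivializationAt (E' := E') x,
    (chartAt E' x).open_source.mem_nhds (mem_chart_source E' x)]
    with y hv hw hcv hcw hchart hyt hy
  set t := trivializationAt E' (fun x : N ↦ TangentSpace 𝓘(ℝ, E') x) x
  have hbracket := mvfderiv_mlieBracket_vector hv hw (contMDiffAt_extChartAt' (n := ∞) hy)
  rw [mvfderiv_congr hcv, mvfderiv_congr hcw, mvfderiv_const, mvfderiv_const, ← hchart,
    ← Trivialization.continuousLinearMapAt_apply_of_mem ℝ _ hyt] at hbracket
  rw [← t.symmL_continuousLinearMapAt (R := ℝ) hyt (mlieBracket _ _ _ y), hbracket]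
  simp only [zero_apply, sub_zero, map_zero]

variable [RiemannianBundle (fun x : N ↦ TangentSpace 𝓘(ℝ, E') x)]
  [IsContMDiffRiemannianBundle 𝓘(ℝ, E') ∞ E' (fun x : N ↦ TangentSpace 𝓘(ℝ, E') x)]

theorem eventually_leviCivita_extend_comm {x : N} (v w : TangentSpace 𝓘(ℝ, E') x) :
    ∀ᶠ y in 𝓝 x, leviCivita (extend E' w) y (extend E' v y)
      = leviCivita (extend E' v) y (extend E' w y) := by
  filter_upwards [eventually_mlieBracket_extend v w,
    eventually_mdifferentiableAt_section (contMDiffAt_extend 𝓘(ℝ, E') E' v),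
    eventually_mdifferentiableAt_section (contMDiffAt_extend 𝓘(ℝ, E') E' w)] with y hy hv hw
  rw [← sub_eq_zero, leviCivita_torsion hv hw, hy]

theorem leviCivita_extend_comm {x : N} (v w : TangentSpace 𝓘(ℝ, E') x) :
    leviCivita (extend E' w) x v = leviCivita (extend E' v) x w := by
  simpa only [extend_apply_self] using (eventually_leviCivita_extend_comm v w).self_of_nhds

variable [IsManifold 𝓘(ℝ, E) ∞ M] [FiniteDimensional ℝ E]
  {F : C^∞⟮𝓘(ℝ, E), M; 𝓘(ℝ, E'), N⟯} {p : M} {X Y : Π q : M, TangentSpace 𝓘(ℝ, E) q}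

theorem covDerivAlong_torsion (hX : CMDiffAt ∞ (T% X) p) (hY : CMDiffAt ∞ (T% Y) p) :
    covDerivAlong F (fun q ↦ differential F q (Y q)) p (X p)
      - covDerivAlong F (fun q ↦ differential F q (X q)) p (Y p)
      = differential F p (mlieBracket 𝓘(ℝ, E) X Y p) := by
  set t := trivializationAt E' (fun x : N ↦ TangentSpace 𝓘(ℝ, E') x) (F p)
  have hchart : CMDiffAt ∞ (fun q ↦ extChartAt 𝓘(ℝ, E') (F p) (F q)) p :=
    contMDiffAt_extChartAt.comp p F.contMDiff.contMDiffAt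
  have hcoord : coordAlong F p (fun q ↦ differential F q (mlieBracket 𝓘(ℝ, E) X Y q)) p
      = d% (coordAlong F p fun q ↦ differential F q (Y q)) p (X p)
        - d% (coordAlong F p fun q ↦ differential F q (X q)) p (Y p) := by
    rw [(eventually_coordAlong_differential F p _).self_of_nhds,
      mvfderiv_congr (eventually_coordAlong_differential F p Y),
      mvfderiv_congr (eventually_coordAlong_differential F p X),
      mvfderiv_mlieBracket_vector hX hY hchart]
  rw [covDerivAlong_apply, covDerivAlong_apply,
    leviCivita_extend_comm (differential F p (X p)) (differential F p (Y p)),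
    add_sub_add_right_eq_sub, ← map_sub, ← hcoord]
  exact symmL_coordAlong (V := fun q ↦ differential F q (mlieBracket 𝓘(ℝ, E) X Y q))

end Torsion

/-! ### The curvature of the pulled back connection -/

section SecondCovDeriv

variable {E : Type*} [NormedAddCommGroup E] [NormedSpace ℝ E]
  {M : Type*} [TopologicalSpace M] [ChartedSpace E M]
  {E' : Type*} [NormedAddCommGroup E'] [NormedSpace ℝ E'] [FiniteDimensional ℝ E']
  {N : Type*} [TopologicalSpace N] [ChartedSpace E' N] [IsManifold 𝓘(ℝ, E') ∞ N]
  [RiemannianBundle (fun x : N ↦ TangentSpace 𝓘(ℝ, E') x)]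
  [IsContMDiffRiemannianBundle 𝓘(ℝ, E') ∞ E' (fun x : N ↦ TangentSpace 𝓘(ℝ, E') x)]
  {S T : Π x : N, TangentSpace 𝓘(ℝ, E') x} {x : N}

/-- The second covariant derivative `∇²_{u,v} S = ∇_u ∇_v S - ∇_{∇_u v} S` of the vector field `S`
at `x`, where `v` is extended to the vector field with constant coordinates in the chart at `x`. -/
def secondCovDeriv (S : Π x : N, TangentSpace 𝓘(ℝ, E') x) (x : N)
    (u v : TangentSpace 𝓘(ℝ, E') x) : TangentSpace 𝓘(ℝ, E') x :=
  leviCivita (fun y ↦ leviCivita S y (extend E' v y)) x u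
    - leviCivita S x (leviCivita (extend E' v) x u)

theorem mdifferentiableAt_leviCivita_extend (hS : CMDiffAt ∞ (T% S) x)
    (v : TangentSpace 𝓘(ℝ, E') x) : MDiffAt (T% (fun y ↦ leviCivita S y (extend E' v y))) x :=
  ContMDiffAt.mdifferentiableAt (contMDiffAt_leviCivita (contMDiffAt_extend 𝓘(ℝ, E') E' v) hS)
    (by simp)

theorem secondCovDeriv_add_left (u u' v : TangentSpace 𝓘(ℝ, E') x) :
    secondCovDeriv S x (u + u') v = secondCovDeriv S x u v + secondCovDeriv S x u' v := by
  simp only [secondCovDeriv, map_add]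
  abel

theorem secondCovDeriv_smul_left (c : ℝ) (u v : TangentSpace 𝓘(ℝ, E') x) :
    secondCovDeriv S x (c • u) v = c • secondCovDeriv S x u v := by
  simp only [secondCovDeriv, map_smul, smul_sub]

theorem secondCovDeriv_add_right (hS : CMDiffAt ∞ (T% S) x) (u v v' : TangentSpace 𝓘(ℝ, E') x) :
    secondCovDeriv S x u (v + v') = secondCovDeriv S x u v + secondCovDeriv S x u v' := by
  have hsum : leviCivita (fun y ↦ leviCivita S y (extend E' (v + v') y)) x =
      leviCivita ((fun y ↦ leviCivita S y (extend E' v y)) +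
        fun y ↦ leviCivita S y (extend E' v' y)) x := by
    refine leviCivita_congr (mdifferentiableAt_leviCivita_extend hS (v + v')) ?_
    filter_upwards [eventually_extend_add v v'] with y hy
    rw [hy, Pi.add_apply, Pi.add_apply, map_add]
  rw [secondCovDeriv, hsum, leviCivita_add (mdifferentiableAt_leviCivita_extend hS v)
    (mdifferentiableAt_leviCivita_extend hS v'), leviCivita_extend_add]
  simp only [secondCovDeriv, add_apply, map_add]
  abel

theorem secondCovDeriv_smul_right (hS : CMDiffAt ∞ (T% S) x) (c : ℝ)
    (u v : TangentSpace 𝓘(ℝ, E') x) :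
    secondCovDeriv S x u (c • v) = c • secondCovDeriv S x u v := by
  have hsmul : leviCivita (fun y ↦ leviCivita S y (extend E' (c • v) y)) x =
      leviCivita (c • fun y ↦ leviCivita S y (extend E' v y)) x := by
    refine leviCivita_congr (mdifferentiableAt_leviCivita_extend hS (c • v)) ?_
    filter_upwards [eventually_extend_smul c v] with y hy
    rw [hy, Pi.smul_apply, Pi.smul_apply, map_smul]
  rw [secondCovDeriv, hsmul, leviCivita_const_smul c (mdifferentiableAt_leviCivita_extend hS v),
    leviCivita_extend_smul]
  simp only [secondCovDeriv, smul_apply, map_smul, smul_sub]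

theorem secondCovDeriv_congr (hS : CMDiffAt ∞ (T% S) x) (h : ∀ᶠ y in 𝓝 x, S y = T y)
    (u v : TangentSpace 𝓘(ℝ, E') x) : secondCovDeriv S x u v = secondCovDeriv T x u v := by
  have hST : ∀ᶠ y in 𝓝 x, leviCivita S y (extend E' v y) = leviCivita T y (extend E' v y) := by
    filter_upwards [eventually_mdifferentiableAt_section hS, h.eventually_nhds] with y hSy hy
    rw [leviCivita_congr hSy hy]
  rw [secondCovDeriv, secondCovDeriv,
    leviCivita_congr (mdifferentiableAt_leviCivita_extend hS v) hST,
    leviCivita_congr (ContMDiffAt.mdifferentiableAt hS (by simp)) h]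

theorem secondCovDeriv_add (hS : CMDiffAt ∞ (T% S) x) (hT : CMDiffAt ∞ (T% T) x)
    (u v : TangentSpace 𝓘(ℝ, E') x) :
    secondCovDeriv (S + T) x u v = secondCovDeriv S x u v + secondCovDeriv T x u v := by
  have hsum : leviCivita (fun y ↦ leviCivita (S + T) y (extend E' v y)) x =
      leviCivita ((fun y ↦ leviCivita S y (extend E' v y)) +
        fun y ↦ leviCivita T y (extend E' v y)) x := by
    refine leviCivita_congr
      (mdifferentiableAt_leviCivita_extend (hS.add_section hT) v) ?_
    filter_upwards [eventually_mdifferentiableAt_section hS,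
      eventually_mdifferentiableAt_section hT] with y hSy hTy
    rw [leviCivita_add hSy hTy]
    rfl
  rw [secondCovDeriv, hsum, leviCivita_add (mdifferentiableAt_leviCivita_extend hS v)
    (mdifferentiableAt_leviCivita_extend hT v),
    leviCivita_add (ContMDiffAt.mdifferentiableAt hS (by simp))
      (ContMDiffAt.mdifferentiableAt hT (by simp))]
  simp only [secondCovDeriv, add_apply]
  abel

theorem secondCovDeriv_const_smul (c : ℝ) (hS : CMDiffAt ∞ (T% S) x)
    (u v : TangentSpace 𝓘(ℝ, E') x) :
    secondCovDeriv (c • S) x u v = c • secondCovDeriv S x u v := by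
  have hsmul : leviCivita (fun y ↦ leviCivita (c • S) y (extend E' v y)) x =
      leviCivita (c • fun y ↦ leviCivita S y (extend E' v y)) x := by
    refine leviCivita_congr
      (mdifferentiableAt_leviCivita_extend (contMDiffAt_const.smul_section hS) v) ?_
    filter_upwards [eventually_mdifferentiableAt_section hS] with y hy
    rw [leviCivita_const_smul c hy]
    rfl
  rw [secondCovDeriv, hsmul, leviCivita_const_smul c (mdifferentiableAt_leviCivita_extend hS v),
    leviCivita_const_smul c (ContMDiffAt.mdifferentiableAt hS (by simp))]
  simp only [secondCovDeriv, smul_apply, smul_sub]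

theorem secondCovDeriv_extend_add (u v w w' : TangentSpace 𝓘(ℝ, E') x) :
    secondCovDeriv (extend E' (w + w')) x u v =
      secondCovDeriv (extend E' w) x u v + secondCovDeriv (extend E' w') x u v := by
  rw [secondCovDeriv_congr (contMDiffAt_extend 𝓘(ℝ, E') E' (w + w')) (eventually_extend_add w w'),
    secondCovDeriv_add (contMDiffAt_extend 𝓘(ℝ, E') E' w) (contMDiffAt_extend 𝓘(ℝ, E') E' w')]

theorem secondCovDeriv_extend_smul (c : ℝ) (u v w : TangentSpace 𝓘(ℝ, E') x) :
    secondCovDeriv (extend E' (c • w)) x u v = c • secondCovDeriv (extend E' w) x u v := by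
  rw [secondCovDeriv_congr (contMDiffAt_extend 𝓘(ℝ, E') E' (c • w)) (eventually_extend_smul c w),
    secondCovDeriv_const_smul c (contMDiffAt_extend 𝓘(ℝ, E') E' w)]

/-- The curvature tensor `R(u, v)w = ∇²_{u,v} w - ∇²_{v,u} w` of `N` at `x`, the `C^∞`-trilinear
counterpart of `curvature`. -/
def curvatureTensor (x : N) : TangentSpace 𝓘(ℝ, E') x →ₗ[ℝ] TangentSpace 𝓘(ℝ, E') x →ₗ[ℝ]
    TangentSpace 𝓘(ℝ, E') x →ₗ[ℝ] TangentSpace 𝓘(ℝ, E') x :=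
  LinearMap.mk₂ ℝ
    (fun u v ↦
      { toFun w := secondCovDeriv (extend E' w) x u v - secondCovDeriv (extend E' w) x v u
        map_add' w w' := by
          simp only [secondCovDeriv_extend_add]
          abel
        map_smul' c w := by
          simp only [secondCovDeriv_extend_smul, smul_sub, RingHom.id_apply] })
    (fun u u' v ↦ by
      ext w
      simp only [LinearMap.coe_mk, AddHom.coe_mk, LinearMap.add_apply, secondCovDeriv_add_left,
        secondCovDeriv_add_right (contMDiffAt_extend 𝓘(ℝ, E') E' w)]
      abel)
    (fun c u v ↦ by
      ext w
      simp only [LinearMap.coe_mk, AddHom.coe_mk, LinearMap.smul_apply, secondCovDeriv_smul_left,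
        secondCovDeriv_smul_right (contMDiffAt_extend 𝓘(ℝ, E') E' w), smul_sub])
    (fun u v v' ↦ by
      ext w
      simp only [LinearMap.coe_mk, AddHom.coe_mk, LinearMap.add_apply, secondCovDeriv_add_left,
        secondCovDeriv_add_right (contMDiffAt_extend 𝓘(ℝ, E') E' w)]
      abel)
    (fun c u v ↦ by
      ext w
      simp only [LinearMap.coe_mk, AddHom.coe_mk, LinearMap.smul_apply, secondCovDeriv_smul_left,
        secondCovDeriv_smul_right (contMDiffAt_extend 𝓘(ℝ, E') E' w), smul_sub])

theorem curvatureTensor_apply (u v w : TangentSpace 𝓘(ℝ, E') x) :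
    curvatureTensor x u v w =
      secondCovDeriv (extend E' w) x u v - secondCovDeriv (extend E' w) x v u :=
  rfl

theorem covDerivAlong_leviCivita {F : C^∞⟮𝓘(ℝ, E), M; 𝓘(ℝ, E'), N⟯} {p : M}
    {V : Π q : M, TangentSpace 𝓘(ℝ, E') (F q)} (hS : CMDiffAt ∞ (T% S) (F p))
    (hV : SmoothAlongAt F V p) (u : TangentSpace 𝓘(ℝ, E) p) :
    covDerivAlong F (fun q ↦ leviCivita S (F q) (V q)) p u =
      secondCovDeriv S (F p) (differential F p u) (V p)
        + leviCivita S (F p) (covDerivAlong F V p u) := by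
  refine hV.induction (Q := fun V ↦ covDerivAlong F (fun q ↦ leviCivita S (F q) (V q)) p u =
    secondCovDeriv S (F p) (differential F p u) (V p)
      + leviCivita S (F p) (covDerivAlong F V p u)) ?_ ?_ ?_ ?_
  · intro V W _ hVW hQ
    have hSVW : ∀ᶠ q in 𝓝 p, leviCivita S (F q) (V q) = leviCivita S (F q) (W q) :=
      hVW.mono fun q hq ↦ by rw [hq]
    rw [← covDerivAlong_congr hSVW, hQ, covDerivAlong_congr hVW, hVW.self_of_nhds]
  · intro V W hV hW hQV hQW
    simp only [map_add]
    rw [covDerivAlong_add (hV.leviCivita hS).mdiffAlongAt (hW.leviCivita hS).mdiffAlongAt,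
      covDerivAlong_add hV.mdiffAlongAt hW.mdiffAlongAt, add_apply, add_apply, hQV, hQW,
      secondCovDeriv_add_right hS, map_add]
    abel
  · intro f V hf hV hQ
    have hfd := hf.mdifferentiableAt (by simp)
    simp only [map_smul]
    rw [covDerivAlong_smul hfd (hV.leviCivita hS).mdiffAlongAt,
      covDerivAlong_smul hfd hV.mdiffAlongAt, hQ, secondCovDeriv_smul_right hS, map_add, map_smul,
      map_smul, smul_add]
    abel
  · intro w
    rw [covDerivAlong_comp (S := fun y ↦ leviCivita S y (extend E' w y))
      (mdifferentiableAt_leviCivita_extend hS w), covDerivAlong_extend]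
    simp only [extend_apply_self]
    rw [secondCovDeriv, sub_add_cancel]

end SecondCovDeriv

section Curvature

variable {E : Type*} [NormedAddCommGroup E] [NormedSpace ℝ E]
  {M : Type*} [TopologicalSpace M] [ChartedSpace E M]
  {E' : Type*} [NormedAddCommGroup E'] [NormedSpace ℝ E'] [FiniteDimensional ℝ E']
  {N : Type*} [TopologicalSpace N] [ChartedSpace E' N] [IsManifold 𝓘(ℝ, E') ∞ N]
  [RiemannianBundle (fun x : N ↦ TangentSpace 𝓘(ℝ, E') x)]
  [IsContMDiffRiemannianBundle 𝓘(ℝ, E') ∞ E' (fun x : N ↦ TangentSpace 𝓘(ℝ, E') x)]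
  {F : C^∞⟮𝓘(ℝ, E), M; 𝓘(ℝ, E'), N⟯} {p : M} {X Y Z : Π q : M, TangentSpace 𝓘(ℝ, E) q}
  {V W : Π q : M, TangentSpace 𝓘(ℝ, E') (F q)} {f : M → ℝ}

/-- The curvature `∇_X ∇_Y V - ∇_Y ∇_X V - ∇_[X,Y] V` of the covariant differentiation of vector
fields along `F`, that is, of the connection on `F^* TN` pulled back from `N`. -/
def curvatureAlong (F : C^∞⟮𝓘(ℝ, E), M; 𝓘(ℝ, E'), N⟯) (X Y : Π q : M, TangentSpace 𝓘(ℝ, E) q)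
    (V : Π q : M, TangentSpace 𝓘(ℝ, E') (F q)) (p : M) : TangentSpace 𝓘(ℝ, E') (F p) :=
  covDerivAlong F (fun q ↦ covDerivAlong F V q (Y q)) p (X p)
    - covDerivAlong F (fun q ↦ covDerivAlong F V q (X q)) p (Y p)
    - covDerivAlong F V p (mlieBracket 𝓘(ℝ, E) X Y p)

theorem curvatureAlong_congr (h : ∀ᶠ q in 𝓝 p, V q = W q) :
    curvatureAlong F X Y V p = curvatureAlong F X Y W p := by
  have hcov (Z : Π q : M, TangentSpace 𝓘(ℝ, E) q) :
      ∀ᶠ q in 𝓝 p, covDerivAlong F V q (Z q) = covDerivAlong F W q (Z q) :=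
    h.eventually_nhds.mono fun q hq ↦ by rw [covDerivAlong_congr hq]
  rw [curvatureAlong, curvatureAlong, covDerivAlong_congr (hcov X), covDerivAlong_congr (hcov Y),
    covDerivAlong_congr h]

variable [IsManifold 𝓘(ℝ, E) ∞ M]

theorem curvatureAlong_add (hX : CMDiffAt ∞ (T% X) p) (hY : CMDiffAt ∞ (T% Y) p)
    (hV : SmoothAlongAt F V p) (hW : SmoothAlongAt F W p) :
    curvatureAlong F X Y (fun q ↦ V q + W q) p
      = curvatureAlong F X Y V p + curvatureAlong F X Y W p := by
  have hcov (Z : Π q : M, TangentSpace 𝓘(ℝ, E) q) : ∀ᶠ q in 𝓝 p,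
      covDerivAlong F (fun q ↦ V q + W q) q (Z q)
        = covDerivAlong F V q (Z q) + covDerivAlong F W q (Z q) := by
    filter_upwards [hV.eventually_mdiffAlongAt, hW.eventually_mdiffAlongAt] with q hVq hWq
    rw [covDerivAlong_add hVq hWq, add_apply]
  simp only [curvatureAlong]
  rw [covDerivAlong_congr (hcov X), covDerivAlong_congr (hcov Y),
    covDerivAlong_add (hV.covDerivAlong hX).mdiffAlongAt (hW.covDerivAlong hX).mdiffAlongAt,
    covDerivAlong_add (hV.covDerivAlong hY).mdiffAlongAt (hW.covDerivAlong hY).mdiffAlongAt,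
    covDerivAlong_add hV.mdiffAlongAt hW.mdiffAlongAt, add_apply, add_apply, add_apply]
  abel

theorem covDerivAlong_covDerivAlong_smul (hZ : CMDiffAt ∞ (T% Z) p) (hf : CMDiffAt ∞ f p)
    (hV : SmoothAlongAt F V p) (u : TangentSpace 𝓘(ℝ, E) p) :
    covDerivAlong F (fun q ↦ covDerivAlong F (fun q ↦ f q • V q) q (Z q)) p u
      = d% (fun q ↦ d% f q (Z q)) p u • V p + d% f p (Z p) • covDerivAlong F V p u
        + (d% f p u • covDerivAlong F V p (Z p)
          + f p • covDerivAlong F (fun q ↦ covDerivAlong F V q (Z q)) p u) := by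
  have hleibniz : ∀ᶠ q in 𝓝 p, covDerivAlong F (fun q ↦ f q • V q) q (Z q)
      = d% f q (Z q) • V q + f q • covDerivAlong F V q (Z q) := by
    filter_upwards [hV.eventually_mdiffAlongAt, eventually_mdifferentiableAt (hf.of_le (by simp))]
      with q hVq hfq
    rw [covDerivAlong_smul hfq hVq]
  have hfZ := contMDiffAt_mvfderiv_apply hf hZ
  rw [covDerivAlong_congr hleibniz, covDerivAlong_add (hV.smul hfZ).mdiffAlongAt
    ((hV.covDerivAlong hZ).smul hf).mdiffAlongAt, add_apply,
    covDerivAlong_smul (hfZ.mdifferentiableAt (by simp)) hV.mdiffAlongAt,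
    covDerivAlong_smul (hf.mdifferentiableAt (by simp)) (hV.covDerivAlong hZ).mdiffAlongAt]

variable [FiniteDimensional ℝ E]

theorem curvatureAlong_smul (hX : CMDiffAt ∞ (T% X) p) (hY : CMDiffAt ∞ (T% Y) p)
    (hf : CMDiffAt ∞ f p) (hV : SmoothAlongAt F V p) :
    curvatureAlong F X Y (fun q ↦ f q • V q) p = f p • curvatureAlong F X Y V p := by
  rw [curvatureAlong, covDerivAlong_covDerivAlong_smul hX hf hV,
    covDerivAlong_covDerivAlong_smul hY hf hV,
    covDerivAlong_smul (hf.mdifferentiableAt (by simp)) hV.mdiffAlongAt,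
    mvfderiv_mlieBracket hX hY hf, curvatureAlong]
  module

theorem curvatureAlong_comp (hX : CMDiffAt ∞ (T% X) p) (hY : CMDiffAt ∞ (T% Y) p)
    {S : Π x : N, TangentSpace 𝓘(ℝ, E') x} (hS : CMDiffAt ∞ (T% S) (F p)) :
    curvatureAlong F X Y (fun q ↦ S (F q)) p =
      secondCovDeriv S (F p) (differential F p (X p)) (differential F p (Y p))
        - secondCovDeriv S (F p) (differential F p (Y p)) (differential F p (X p)) := by
  have hcomp (Z : Π q : M, TangentSpace 𝓘(ℝ, E) q) : ∀ᶠ q in 𝓝 p,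
      covDerivAlong F (fun q ↦ S (F q)) q (Z q)
        = leviCivita S (F q) (differential F q (Z q)) := by
    filter_upwards [F.contMDiff.continuous.continuousAt.eventually
      (eventually_mdifferentiableAt_section hS)] with q hq
    exact covDerivAlong_comp hq _
  rw [curvatureAlong, covDerivAlong_congr (hcomp X), covDerivAlong_congr (hcomp Y),
    covDerivAlong_leviCivita hS (.differential hX), covDerivAlong_leviCivita hS (.differential hY),
    covDerivAlong_comp (ContMDiffAt.mdifferentiableAt hS (by simp)), ← covDerivAlong_torsion hX hY,
    map_sub]
  abel

theorem curvatureAlong_eq (hX : CMDiffAt ∞ (T% X) p) (hY : CMDiffAt ∞ (T% Y) p)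
    (hV : SmoothAlongAt F V p) :
    curvatureAlong F X Y V p =
      curvatureTensor (F p) (differential F p (X p)) (differential F p (Y p)) (V p) := by
  refine hV.induction (Q := fun V ↦ curvatureAlong F X Y V p =
    curvatureTensor (F p) (differential F p (X p)) (differential F p (Y p)) (V p)) ?_ ?_ ?_ ?_
  · intro V W _ hVW hQ
    rw [← curvatureAlong_congr hVW, hQ, hVW.self_of_nhds]
  · intro V W hV hW hQV hQW
    rw [curvatureAlong_add hX hY hV hW, hQV, hQW, map_add]
  · intro f V hf hV hQ
    rw [curvatureAlong_smul hX hY hf hV, hQ, map_smul]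
  · intro w
    rw [curvatureAlong_comp hX hY (contMDiffAt_extend 𝓘(ℝ, E') E' w)]
    simp only [extend_apply_self]
    rw [curvatureTensor_apply]

end Curvature

/-! ### Algebra of curvature tensors -/

section Algebra

variable {V : Type*} [NormedAddCommGroup V] [InnerProductSpace ℝ V]

theorem linearIndependent_pair_of_inner {u v : V}
    (h : inner ℝ u u * inner ℝ v v - inner ℝ u v ^ 2 ≠ 0) : LinearIndependent ℝ ![u, v] := by
  rw [LinearIndependent.pair_iff]
  intro s t hst
  have hu := congrArg (fun w ↦ inner ℝ w u) hst
  have hv := congrArg (fun w ↦ inner ℝ w v) hst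
  simp only [inner_add_left, real_inner_smul_left, inner_zero_left, real_inner_comm u v] at hu hv
  constructor
  · refine (mul_eq_zero.1 ?_).resolve_right h
    linear_combination inner ℝ v v * hu - inner ℝ u v * hv
  · refine (mul_eq_zero.1 ?_).resolve_right h
    linear_combination inner ℝ u u * hv - inner ℝ u v * hu

/-- The symmetries of the curvature tensor of a Riemannian manifold. -/
structure IsCurvatureLike (R : V →ₗ[ℝ] V →ₗ[ℝ] V →ₗ[ℝ] V) : Prop where
  swap (u v w : V) : R u v w = -R v u w
  inner_self (u v w : V) : inner ℝ (R u v w) w = 0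
  bianchi (u v w : V) : R u v w + R v w u + R w u v = 0

namespace IsCurvatureLike

variable {R : V →ₗ[ℝ] V →ₗ[ℝ] V →ₗ[ℝ] V}

theorem inner_swap (h : IsCurvatureLike R) (u v w z : V) :
    inner ℝ (R u v w) z = -inner ℝ (R v u w) z := by
  rw [h.swap, inner_neg_left]

theorem inner_skew (h : IsCurvatureLike R) (u v w z : V) :
    inner ℝ (R u v w) z = -inner ℝ (R u v z) w := by
  have hadd := h.inner_self u v (w + z)
  rw [map_add, inner_add_left, inner_add_right, inner_add_right, h.inner_self, h.inner_self] at hadd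
  linarith

theorem inner_bianchi (h : IsCurvatureLike R) (u v w z : V) :
    inner ℝ (R u v w) z + inner ℝ (R v w u) z + inner ℝ (R w u v) z = 0 := by
  rw [← inner_add_left, ← inner_add_left, h.bianchi, inner_zero_left]

theorem two_mul_inner (h : IsCurvatureLike R) (u v w z : V) :
    2 * inner ℝ (R u v w) z = inner ℝ (R v z u) w + inner ℝ (R z u v) w
      - inner ℝ (R v w u) z - inner ℝ (R w u v) z := by
  linear_combination h.inner_bianchi u v w z - h.inner_bianchi u v z w + h.inner_skew u v w z

theorem inner_pair (h : IsCurvatureLike R) (u v w z : V) :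
    inner ℝ (R u v w) z = inner ℝ (R w z u) v := by
  linear_combination (h.two_mul_inner u v w z - h.two_mul_inner w z u v
    + h.inner_swap v z u w - h.inner_skew z v u w + h.inner_skew z u v w - h.inner_skew v w u z
    + h.inner_swap u w z v - h.inner_skew w u z v) / 2

theorem inner_eq_zero (h : IsCurvatureLike R) {u v : V}
    (huv : inner ℝ u u * inner ℝ v v - inner ℝ u v ^ 2 = 0) : inner ℝ (R u v v) u = 0 := by
  by_cases hu : u = 0
  · simp only [hu, inner_zero_right]
  have hparallel : inner ℝ u u • v - inner ℝ u v • u = 0 := by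
    rw [← inner_self_eq_zero (𝕜 := ℝ)]
    simp only [inner_sub_left, inner_sub_right, real_inner_smul_left, real_inner_smul_right,
      real_inner_comm u v]
    linear_combination inner ℝ u u * huv
  have hRuu : inner ℝ (R u u v) u = 0 := by linarith [h.inner_swap u u v u]
  have hRuv := congrArg (fun w ↦ inner ℝ (R u w v) u) (sub_eq_zero.1 hparallel)
  simp only [map_smul, LinearMap.smul_apply, real_inner_smul_left, hRuu, mul_zero] at hRuv
  exact (mul_eq_zero.1 hRuv).resolve_left (inner_self_ne_zero.2 hu)

theorem inner_left_eq_of_sectional (h : IsCurvatureLike R) {c : ℝ}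
    (hc : ∀ u v : V, inner ℝ (R u v v) u = c * (inner ℝ u u * inner ℝ v v - inner ℝ u v ^ 2))
    (u v w : V) :
    inner ℝ (R u v w) u = c * (inner ℝ u u * inner ℝ v w - inner ℝ u v * inner ℝ u w) := by
  have hsum := hc u (v + w)
  simp only [map_add, LinearMap.add_apply, inner_add_left, inner_add_right] at hsum
  have hsymm : inner ℝ (R u w v) u = inner ℝ (R u v w) u := by
    rw [h.inner_pair u w v u, h.inner_swap, h.inner_skew, neg_neg]
  linear_combination (hsum - hc u v - hc u w - hsymm + c * inner ℝ u u * real_inner_comm v w) / 2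

theorem inner_add_inner_eq_of_sectional (h : IsCurvatureLike R) {c : ℝ}
    (hc : ∀ u v : V, inner ℝ (R u v v) u = c * (inner ℝ u u * inner ℝ v v - inner ℝ u v ^ 2))
    (u v w z : V) :
    inner ℝ (R u v w) z + inner ℝ (R u w v) z
      = c * (2 * inner ℝ u z * inner ℝ v w - inner ℝ u v * inner ℝ z w
        - inner ℝ z v * inner ℝ u w) := by
  have hsum := h.inner_left_eq_of_sectional hc (u + z) v w
  simp only [map_add, LinearMap.add_apply, inner_add_left, inner_add_right] at hsum
  have hsymm : inner ℝ (R z v w) u = inner ℝ (R u w v) z := by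
    rw [h.inner_pair z v w u, h.inner_swap, h.inner_skew, neg_neg]
  linear_combination hsum - h.inner_left_eq_of_sectional hc u v w
    - h.inner_left_eq_of_sectional hc z v w - hsymm + c * inner ℝ v w * real_inner_comm u z

theorem eq_of_sectional (h : IsCurvatureLike R) {c : ℝ}
    (hc : ∀ u v : V, inner ℝ (R u v v) u = c * (inner ℝ u u * inner ℝ v v - inner ℝ u v ^ 2))
    (u v w : V) : R u v w = (c * inner ℝ v w) • u - (c * inner ℝ u w) • v := by
  refine ext_inner_right ℝ fun z ↦ ?_
  rw [inner_sub_left, real_inner_smul_left, real_inner_smul_left]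
  have huv := h.inner_add_inner_eq_of_sectional hc u v w z
  have hvu := h.inner_add_inner_eq_of_sectional hc v u w z
  rw [real_inner_comm v z] at huv
  rw [real_inner_comm u z, real_inner_comm u v] at hvu
  linear_combination (huv - hvu + h.inner_bianchi u v w z + h.inner_swap v u w z
    - h.inner_swap w u v z) / 3

section Kaehler

variable {J : V →L[ℝ] V} (hJ : ∀ v w : V, inner ℝ (J v) (J w) = inner ℝ v w)
  (hRJ : ∀ u v w, R u v (J w) = J (R u v w))

include hJ hRJ

theorem inner_map_map_left (h : IsCurvatureLike R) (u v w z : V) :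
    inner ℝ (R (J u) (J v) w) z = inner ℝ (R u v w) z := by
  rw [h.inner_pair, hRJ, hJ, ← h.inner_pair]

variable (hJJ : ∀ v, J (J v) = -v)

include hJJ

theorem inner_map_middle_comm (h : IsCurvatureLike R) (u v w z : V) :
    inner ℝ (R u (J v) w) z = inner ℝ (R v (J u) w) z := by
  rw [← h.inner_map_map_left hJ hRJ u (J v), hJJ, map_neg, LinearMap.neg_apply, inner_neg_left,
    h.inner_swap, neg_neg]

theorem inner_map_right_comm (h : IsCurvatureLike R) (u v w z : V) :
    inner ℝ (R u v (J w)) z = inner ℝ (R u v (J z)) w := by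
  rw [← hJ, ← hRJ, hJJ, map_neg, inner_neg_left, h.inner_skew, neg_neg]

variable {μ : ℝ} (hμ : ∀ u, inner ℝ (R u (J u) (J u)) u = μ * inner ℝ u u ^ 2)

include hμ

theorem inner_add_three_mul_inner (h : IsCurvatureLike R) {u v : V} (huv : inner ℝ u v = 0) :
    inner ℝ (R u v v) u + 3 * inner ℝ (R u (J v) (J v)) u = μ * (inner ℝ u u * inner ℝ v v) := by
  have hvu : inner ℝ v u = 0 := by rw [real_inner_comm, huv]
  have hadd := hμ (u + v)
  have hsub := hμ (u - v)
  simp only [map_add, map_sub, LinearMap.add_apply, LinearMap.sub_apply, inner_add_left,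
    inner_add_right, inner_sub_left, inner_sub_right, huv, hvu] at hadd hsub
  have hpair : inner ℝ (R v (J v) (J u)) u = inner ℝ (R u (J u) (J v)) v := by
    rw [h.inner_pair, h.inner_swap, h.inner_skew, neg_neg]
  have hmiddle := h.inner_map_middle_comm hJ hRJ hJJ v u
  have hright := h.inner_map_right_comm hJ hRJ hJJ u (J v)
  have hbianchi := h.inner_bianchi u (J u) (J v) v
  rw [h.inner_map_map_left hJ hRJ, h.inner_skew u v u v, h.inner_swap (J v) u, hright] at hbianchi
  linear_combination (hadd + hsub) / 4 - hμ u / 2 - hμ v / 2 - hpair / 2 - hbianchi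
    - hmiddle (J v) u / 2 - hmiddle (J u) v / 2 - hright u v

theorem inner_eq_of_totallyReal (h : IsCurvatureLike R) {u v : V} (huv : inner ℝ u v = 0)
    (huJv : inner ℝ u (J v) = 0) :
    inner ℝ (R u v v) u = μ / 4 * (inner ℝ u u * inner ℝ v v) := by
  have hv := h.inner_add_three_mul_inner hJ hRJ hJJ hμ huv
  have hJv := h.inner_add_three_mul_inner hJ hRJ hJJ hμ huJv
  simp only [hJJ, map_neg, LinearMap.neg_apply, neg_neg, hJ] at hJv
  linarith

end Kaehler

end IsCurvatureLike

end Algebra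

/-! ### The curvature tensor of a Riemannian manifold -/

section CurvatureTensor

variable {E : Type*} [NormedAddCommGroup E] [NormedSpace ℝ E] [FiniteDimensional ℝ E]
  {M : Type*} [TopologicalSpace M] [ChartedSpace E M] [IsManifold 𝓘(ℝ, E) ∞ M]
  [RiemannianBundle (fun x : M ↦ TangentSpace 𝓘(ℝ, E) x)]
  [IsContMDiffRiemannianBundle 𝓘(ℝ, E) ∞ E (fun x : M ↦ TangentSpace 𝓘(ℝ, E) x)]
  {x : M} {S X Y Z : Π x : M, TangentSpace 𝓘(ℝ, E) x}

theorem leviCivita_leviCivita (hS : CMDiffAt ∞ (T% S) x) (hY : CMDiffAt ∞ (T% Y) x)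
    (u : TangentSpace 𝓘(ℝ, E) x) :
    leviCivita (fun y ↦ leviCivita S y (Y y)) x u =
      secondCovDeriv S x u (Y x) + leviCivita S x (leviCivita Y x u) := by
  let idM : C^∞⟮𝓘(ℝ, E), M; 𝓘(ℝ, E), M⟯ := .id
  have hcov := covDerivAlong_leviCivita (F := idM) (p := x) hS hY u
  rw [differential_id, covDerivAlong_id (ContMDiffAt.mdifferentiableAt hY (by simp))] at hcov
  exact (covDerivAlong_id
    (ContMDiffAt.mdifferentiableAt (contMDiffAt_leviCivita hY hS) (by simp)) u).symm.trans hcov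

theorem secondCovDeriv_sub_swap (hS : CMDiffAt ∞ (T% S) x) (u v : TangentSpace 𝓘(ℝ, E) x) :
    secondCovDeriv S x u v - secondCovDeriv S x v u = curvatureTensor x u v (S x) := by
  let idM : C^∞⟮𝓘(ℝ, E), M; 𝓘(ℝ, E), M⟯ := .id
  have hu := contMDiffAt_extend (k := ∞) 𝓘(ℝ, E) E u
  have hv := contMDiffAt_extend (k := ∞) 𝓘(ℝ, E) E v
  have hcurv := (curvatureAlong_comp (F := idM) (p := x) hu hv hS).symm.trans
    (curvatureAlong_eq (F := idM) hu hv (.comp hS))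
  have hid (w : TangentSpace 𝓘(ℝ, E) x) : differential idM x w = w := differential_id x w
  rw [hid, hid, extend_apply_self, extend_apply_self] at hcurv
  exact hcurv

theorem curvature_eq_curvatureTensor (hX : CMDiffAt ∞ (T% X) x) (hY : CMDiffAt ∞ (T% Y) x)
    (hZ : CMDiffAt ∞ (T% Z) x) : curvature X Y Z x = curvatureTensor x (X x) (Y x) (Z x) := by
  rw [curvature, leviCivita_leviCivita hZ hY, leviCivita_leviCivita hZ hX,
    ← leviCivita_torsion (ContMDiffAt.mdifferentiableAt hX (by simp))
      (ContMDiffAt.mdifferentiableAt hY (by simp)), map_sub, ← secondCovDeriv_sub_swap hZ]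
  abel

theorem curvatureTensor_eq_leviCivita_leviCivita (u v w : TangentSpace 𝓘(ℝ, E) x) :
    curvatureTensor x u v w = leviCivita (fun y ↦ leviCivita (extend E w) y (extend E v y)) x u
      - leviCivita (fun y ↦ leviCivita (extend E w) y (extend E u y)) x v := by
  rw [curvatureTensor_apply, secondCovDeriv, secondCovDeriv, leviCivita_extend_comm u v,
    sub_sub_sub_cancel_right]

theorem curvatureTensor_swap (u v w : TangentSpace 𝓘(ℝ, E) x) :
    curvatureTensor x u v w = -curvatureTensor x v u w := by
  rw [curvatureTensor_apply, curvatureTensor_apply, neg_sub]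

theorem mvfderiv_mvfderiv_inner_extend (u v w : TangentSpace 𝓘(ℝ, E) x) :
    d% (fun y ↦ d% (fun y ↦ inner ℝ (extend E w y) (extend E w y)) y (extend E v y)) x u =
      2 * (inner ℝ (leviCivita (fun y ↦ leviCivita (extend E w) y (extend E v y)) x u) w
        + inner ℝ (leviCivita (extend E w) x v) (leviCivita (extend E w) x u)) := by
  have hw := contMDiffAt_extend (k := ∞) 𝓘(ℝ, E) E w
  have hmetric : ∀ᶠ y in 𝓝 x, d% (fun y ↦ inner ℝ (extend E w y) (extend E w y)) y (extend E v y)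
      = 2 * inner ℝ (leviCivita (extend E w) y (extend E v y)) (extend E w y) := by
    filter_upwards [eventually_mdifferentiableAt_section hw,
      eventually_mdifferentiableAt_section (contMDiffAt_extend 𝓘(ℝ, E) E v)] with y hwy hvy
    rw [leviCivita_metric hvy hwy hwy, real_inner_comm, two_mul]
  have hL := mdifferentiableAt_leviCivita_extend hw v
  have hderiv := leviCivita_metric (mdifferentiableAt_extend 𝓘(ℝ, E) E u) hL
    (mdifferentiableAt_extend 𝓘(ℝ, E) E w)
  simp only [extend_apply_self] at hderiv
  rw [mvfderiv_congr hmetric, mvfderiv_fun_mul mdifferentiableAt_const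
    (mdifferentiableAt_inner hL (mdifferentiableAt_extend 𝓘(ℝ, E) E w)), ← hderiv]
  simp [mvfderiv_const]

theorem inner_curvatureTensor_self (u v w : TangentSpace 𝓘(ℝ, E) x) :
    inner ℝ (curvatureTensor x u v w) w = 0 := by
  have hw := contMDiffAt_extend (k := ∞) 𝓘(ℝ, E) E w
  have hsymm := mvfderiv_mlieBracket (contMDiffAt_extend 𝓘(ℝ, E) E u)
    (contMDiffAt_extend 𝓘(ℝ, E) E v) (contMDiffAt_inner_bundle hw hw)
  rw [(eventually_mlieBracket_extend u v).self_of_nhds, map_zero, extend_apply_self,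
    extend_apply_self, mvfderiv_mvfderiv_inner_extend, mvfderiv_mvfderiv_inner_extend,
    real_inner_comm (leviCivita (extend E w) x u)] at hsymm
  rw [curvatureTensor_eq_leviCivita_leviCivita, inner_sub_left]
  linarith

theorem curvatureTensor_bianchi (u v w : TangentSpace 𝓘(ℝ, E) x) :
    curvatureTensor x u v w + curvatureTensor x v w u + curvatureTensor x w u v = 0 := by
  have hsymm (v w : TangentSpace 𝓘(ℝ, E) x) :
      leviCivita (fun y ↦ leviCivita (extend E w) y (extend E v y)) x
        = leviCivita (fun y ↦ leviCivita (extend E v) y (extend E w y)) x :=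
    leviCivita_congr (mdifferentiableAt_leviCivita_extend (contMDiffAt_extend 𝓘(ℝ, E) E w) v)
      (eventually_leviCivita_extend_comm v w)
  simp only [curvatureTensor_eq_leviCivita_leviCivita]
  rw [hsymm v w, hsymm u w, hsymm u v]
  abel

theorem isCurvatureLike_curvatureTensor (x : M) :
    IsCurvatureLike (V := TangentSpace 𝓘(ℝ, E) x) (curvatureTensor x) where
  swap := curvatureTensor_swap
  inner_self := inner_curvatureTensor_self
  bianchi := curvatureTensor_bianchi

theorem HasConstantCurvature.curvatureTensor_eq {c : ℝ} (hc : HasConstantCurvature E M c)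
    (u v w : TangentSpace 𝓘(ℝ, E) x) :
    curvatureTensor x u v w = (c * inner ℝ v w) • u - (c * inner ℝ u w) • v := by
  have hR := isCurvatureLike_curvatureTensor (E := E) x
  refine hR.eq_of_sectional (V := TangentSpace 𝓘(ℝ, E) x) (fun u v ↦ ?_) u v w
  by_cases hd : inner ℝ u u * inner ℝ v v - inner ℝ u v ^ 2 = 0
  · rw [hd, mul_zero]
    exact hR.inner_eq_zero hd
  · have hu := contMDiffAt_extend (k := ∞) 𝓘(ℝ, E) E u
    have hv := contMDiffAt_extend (k := ∞) 𝓘(ℝ, E) E v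
    have hsec := hc x (extend E u) (extend E v) hu hv
      (by simpa using linearIndependent_pair_of_inner hd)
    rw [sectionalCurvature, curvature_eq_curvatureTensor hu hv hv] at hsec
    simp only [extend_apply_self] at hsec
    rw [← hsec, div_mul_cancel₀ _ hd]

variable {J : Π x : M, TangentSpace 𝓘(ℝ, E) x →L[ℝ] TangentSpace 𝓘(ℝ, E) x}

theorem IsKaehler.leviCivita_comm (hJ : IsKaehler J) (hS : MDiffAt (T% S) x)
    (u : TangentSpace 𝓘(ℝ, E) x) :
    leviCivita (fun y ↦ J y (S y)) x u = J x (leviCivita S x u) := by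
  let idM : C^∞⟮𝓘(ℝ, E), M; 𝓘(ℝ, E), M⟯ := .id
  have hJS : MDiffAt (T% (fun y ↦ J y (S y))) x := MDiffAlongAt.kaehler (F := idM) hJ hS
  rw [← covDerivAlong_id hJS, ← covDerivAlong_id hS]
  exact covDerivAlong_kaehler (F := idM) hJ hS u

theorem IsKaehler.secondCovDeriv_comm (hJ : IsKaehler J) (hS : CMDiffAt ∞ (T% S) x)
    (u v : TangentSpace 𝓘(ℝ, E) x) :
    secondCovDeriv (fun y ↦ J y (S y)) x u v = J x (secondCovDeriv S x u v) := by
  have hcomm : ∀ᶠ y in 𝓝 x, leviCivita (fun y ↦ J y (S y)) y (extend E v y)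
      = J y (leviCivita S y (extend E v y)) :=
    (eventually_mdifferentiableAt_section hS).mono fun y hy ↦ hJ.leviCivita_comm hy _
  rw [secondCovDeriv, leviCivita_congr
      (mdifferentiableAt_leviCivita_extend (contMDiffAt_kaehler hJ hS) v) hcomm,
    hJ.leviCivita_comm (mdifferentiableAt_leviCivita_extend hS v),
    hJ.leviCivita_comm (ContMDiffAt.mdifferentiableAt hS (by simp)), ← map_sub, secondCovDeriv]

theorem IsKaehler.curvatureTensor_comm (hJ : IsKaehler J) (u v w : TangentSpace 𝓘(ℝ, E) x) :
    curvatureTensor x u v (J x w) = J x (curvatureTensor x u v w) := by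
  have hw := contMDiffAt_extend (k := ∞) 𝓘(ℝ, E) E w
  have hricci := secondCovDeriv_sub_swap (contMDiffAt_kaehler hJ hw) u v
  rw [hJ.secondCovDeriv_comm hw, hJ.secondCovDeriv_comm hw, ← map_sub, extend_apply_self] at hricci
  rw [← hricci, curvatureTensor_apply]

theorem IsKaehler.inner_skew (hJ : IsKaehler J) (v w : TangentSpace 𝓘(ℝ, E) x) :
    inner ℝ (J x v) w = -inner ℝ v (J x w) := by
  rw [← hJ.isometry x v (J x w), hJ.sq, inner_neg_right, neg_neg]

theorem IsKaehler.inner_self (hJ : IsKaehler J) (u : TangentSpace 𝓘(ℝ, E) x) :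
    inner ℝ u (J x u) = 0 := by
  linarith [hJ.inner_skew u u, real_inner_comm u (J x u)]

theorem IsComplexSpaceForm.inner_curvatureTensor {μ : ℝ} (hM : IsComplexSpaceForm J μ)
    (u : TangentSpace 𝓘(ℝ, E) x) :
    inner ℝ (curvatureTensor x u (J x u) (J x u)) u = μ * inner ℝ u u ^ 2 := by
  by_cases hu : u = 0
  · simp [hu]
  have hX := contMDiffAt_extend (k := ∞) 𝓘(ℝ, E) E u
  have hJX := contMDiffAt_kaehler hM.isKaehler hX
  have hsec := hM.holomorphic_curvature x (extend E u) hX (by simpa using hu)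
  rw [sectionalCurvature, curvature_eq_curvatureTensor hX hJX hJX] at hsec
  simp only [extend_apply_self, hM.isKaehler.isometry, hM.isKaehler.inner_self] at hsec
  rw [div_eq_iff (by simpa using hu)] at hsec
  rw [hsec]
  ring

end CurvatureTensor

/-! ### The second fundamental form -/

section SecondFundamentalForm

variable {E : Type*} [NormedAddCommGroup E] [NormedSpace ℝ E] [FiniteDimensional ℝ E]
  {M : Type*} [TopologicalSpace M] [ChartedSpace E M] [IsManifold 𝓘(ℝ, E) ∞ M]
  [RiemannianBundle (fun x : M ↦ TangentSpace 𝓘(ℝ, E) x)]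
  [IsContMDiffRiemannianBundle 𝓘(ℝ, E) ∞ E (fun x : M ↦ TangentSpace 𝓘(ℝ, E) x)]
  {E' : Type*} [NormedAddCommGroup E'] [NormedSpace ℝ E'] [FiniteDimensional ℝ E']
  {N : Type*} [TopologicalSpace N] [ChartedSpace E' N] [IsManifold 𝓘(ℝ, E') ∞ N]
  [RiemannianBundle (fun x : N ↦ TangentSpace 𝓘(ℝ, E') x)]
  [IsContMDiffRiemannianBundle 𝓘(ℝ, E') ∞ E' (fun x : N ↦ TangentSpace 𝓘(ℝ, E') x)]
  {F : C^∞⟮𝓘(ℝ, E), M; 𝓘(ℝ, E'), N⟯} {p : M} {X Y : Π q : M, TangentSpace 𝓘(ℝ, E) q}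

theorem tensorialAt_secondFundamentalForm (F : C^∞⟮𝓘(ℝ, E), M; 𝓘(ℝ, E'), N⟯) (p : M)
    (X : Π q : M, TangentSpace 𝓘(ℝ, E) q) :
    TensorialAt 𝓘(ℝ, E) E (fun Y ↦ secondFundamentalForm F X Y p) p where
  smul {f Y} hf hY := by
    simp only [secondFundamentalForm, Pi.smul_apply', map_smul]
    rw [covDerivAlong_smul hf (MDiffAlongAt.differential hY), leviCivita_smul hf hY]
    simp only [add_apply, smul_apply, ContinuousLinearMap.smulRight_apply, map_add, map_smul]
    module
  add {Y Z} hY hZ := by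
    simp only [secondFundamentalForm, Pi.add_apply, map_add]
    rw [covDerivAlong_add (MDiffAlongAt.differential hY) (MDiffAlongAt.differential hZ),
      leviCivita_add hY hZ, add_apply, add_apply, map_add]
    abel

theorem secondFundamentalForm_extend_add (u v w : TangentSpace 𝓘(ℝ, E) p) :
    secondFundamentalForm F (extend E u) (extend E (v + w)) p =
      secondFundamentalForm F (extend E u) (extend E v) p
        + secondFundamentalForm F (extend E u) (extend E w) p := by
  have htensor := tensorialAt_secondFundamentalForm F p (extend E u)
  have hd (v : TangentSpace 𝓘(ℝ, E) p) := mdifferentiableAt_extend 𝓘(ℝ, E) E v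
  rw [← htensor.add (hd v) (hd w)]
  exact htensor.pointwise (hd (v + w)) (mdifferentiableAt_add_section (hd v) (hd w)) (by simp)

theorem secondFundamentalForm_extend_smul (a : ℝ) (u v : TangentSpace 𝓘(ℝ, E) p) :
    secondFundamentalForm F (extend E u) (extend E (a • v)) p =
      a • secondFundamentalForm F (extend E u) (extend E v) p := by
  have htensor := tensorialAt_secondFundamentalForm F p (extend E u)
  have hd (v : TangentSpace 𝓘(ℝ, E) p) := mdifferentiableAt_extend 𝓘(ℝ, E) E v
  have ha : MDiffAt (fun _ : M ↦ a) p := mdifferentiableAt_const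
  exact (htensor.pointwise (hd (a • v)) (ha.smul_section (hd v)) (by simp)).trans
    (htensor.smul ha (hd v))

/-- The second fundamental form at `p`, as a bilinear map on `T_p M`. Its value at `u` and `v` is
computed from the extensions of `u` and `v` that are constant in a chart. -/
def sffTensor (F : C^∞⟮𝓘(ℝ, E), M; 𝓘(ℝ, E'), N⟯) (p : M) : TangentSpace 𝓘(ℝ, E) p →ₗ[ℝ]
    TangentSpace 𝓘(ℝ, E) p →ₗ[ℝ] TangentSpace 𝓘(ℝ, E') (F p) :=
  LinearMap.mk₂ ℝ (fun u v ↦ secondFundamentalForm F (extend E u) (extend E v) p)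
    (fun u u' v ↦ by simp only [secondFundamentalForm, extend_apply_self, map_add]; abel)
    (fun a u v ↦ by simp only [secondFundamentalForm, extend_apply_self, map_smul, smul_sub])
    secondFundamentalForm_extend_add secondFundamentalForm_extend_smul

theorem secondFundamentalForm_eq_sffTensor (hY : MDiffAt (T% Y) p) :
    secondFundamentalForm F X Y p = sffTensor F p (X p) (Y p) := by
  rw [(tensorialAt_secondFundamentalForm F p X).pointwise hY
      (mdifferentiableAt_extend 𝓘(ℝ, E) E (Y p)) (by simp), sffTensor, LinearMap.mk₂_apply,
    secondFundamentalForm, secondFundamentalForm, extend_apply_self]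

theorem covDerivAlong_differential (hY : MDiffAt (T% Y) p) (u : TangentSpace 𝓘(ℝ, E) p) :
    covDerivAlong F (fun q ↦ differential F q (Y q)) p u
      = differential F p (leviCivita Y p u) + sffTensor F p u (Y p) := by
  have hσ := secondFundamentalForm_eq_sffTensor (F := F) (X := extend E u) hY
  rw [secondFundamentalForm, extend_apply_self] at hσ
  rw [← hσ, add_sub_cancel]

theorem sffTensor_comm (u v : TangentSpace 𝓘(ℝ, E) p) : sffTensor F p u v = sffTensor F p v u := by
  have hd (v : TangentSpace 𝓘(ℝ, E) p) := mdifferentiableAt_extend 𝓘(ℝ, E) E v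
  have htorsion := covDerivAlong_torsion (F := F) (contMDiffAt_extend (k := ∞) 𝓘(ℝ, E) E u)
    (contMDiffAt_extend (k := ∞) 𝓘(ℝ, E) E v)
  rw [covDerivAlong_differential (hd v), covDerivAlong_differential (hd u),
    ← leviCivita_torsion (hd u) (hd v), map_sub] at htorsion
  simp only [extend_apply_self] at htorsion
  rw [← sub_eq_zero] at htorsion ⊢
  rw [← htorsion]
  abel

theorem inner_sffTensor_differential_swap (hF : IsIsometricImmersion F)
    (u v w : TangentSpace 𝓘(ℝ, E) p) :
    inner ℝ (sffTensor F p u v) (differential F p w) =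
      -inner ℝ (sffTensor F p u w) (differential F p v) := by
  have hd (v : TangentSpace 𝓘(ℝ, E) p) := mdifferentiableAt_extend 𝓘(ℝ, E) E v
  have hN := mvfderiv_inner_along (MDiffAlongAt.differential (F := F) (hd v))
    (MDiffAlongAt.differential (F := F) (hd w)) u
  have hM := leviCivita_metric (hd u) (hd v) (hd w)
  simp only [hF _ _ _] at hN
  simp only [extend_apply_self] at hM
  rw [hM, covDerivAlong_differential (hd v), covDerivAlong_differential (hd w), inner_add_left,
    inner_add_right] at hN
  simp only [extend_apply_self, hF _ _ _] at hN
  linarith [real_inner_comm (sffTensor F p u w) (differential F p v)]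

theorem inner_sffTensor_differential (hF : IsIsometricImmersion F)
    (u v w : TangentSpace 𝓘(ℝ, E) p) :
    inner ℝ (sffTensor F p u v) (differential F p w) = 0 := by
  -- A trilinear form symmetric in one pair of arguments and skew in another one vanishes.
  have hskew := inner_sffTensor_differential_swap hF u v w
  rw [sffTensor_comm u w, inner_sffTensor_differential_swap hF w u v, sffTensor_comm w v,
    inner_sffTensor_differential_swap hF v w u, sffTensor_comm v u] at hskew
  linarith

theorem isTotallyGeodesic_iff : IsTotallyGeodesic F ↔ ∀ q, sffTensor F q = 0 := by
  refine ⟨fun hF q ↦ LinearMap.ext₂ fun u v ↦ hF q _ _ (contMDiffAt_extend 𝓘(ℝ, E) E u)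
    (contMDiffAt_extend 𝓘(ℝ, E) E v), fun hσ q X Y _ hY ↦ ?_⟩
  rw [secondFundamentalForm_eq_sffTensor (ContMDiffAt.mdifferentiableAt hY (by simp)), hσ,
    LinearMap.zero_apply, LinearMap.zero_apply]

theorem IsTotallyGeodesic.covDerivAlong_differential (hF : IsTotallyGeodesic F)
    (hY : MDiffAt (T% Y) p) (u : TangentSpace 𝓘(ℝ, E) p) :
    covDerivAlong F (fun q ↦ differential F q (Y q)) p u
      = differential F p (leviCivita Y p u) := by
  rw [TotallyReal.covDerivAlong_differential hY, isTotallyGeodesic_iff.1 hF, LinearMap.zero_apply,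
    LinearMap.zero_apply, add_zero]

theorem IsTotallyGeodesic.covDerivAlong_covDerivAlong_differential (hF : IsTotallyGeodesic F)
    (hX : CMDiffAt ∞ (T% X) p) (hY : CMDiffAt ∞ (T% Y) p) (u : TangentSpace 𝓘(ℝ, E) p) :
    covDerivAlong F (fun q ↦ covDerivAlong F (fun q ↦ differential F q (Y q)) q (X q)) p u
      = differential F p (leviCivita (fun q ↦ leviCivita Y q (X q)) p u) := by
  rw [← hF.covDerivAlong_differential
    (ContMDiffAt.mdifferentiableAt (contMDiffAt_leviCivita hX hY) (by simp)), covDerivAlong_congr]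
  filter_upwards [eventually_mdifferentiableAt_section hY] with q hq
  exact hF.covDerivAlong_differential hq _

theorem IsTotallyGeodesic.curvatureTensor_differential (hF : IsTotallyGeodesic F)
    (u v w : TangentSpace 𝓘(ℝ, E) p) :
    curvatureTensor (F p) (differential F p u) (differential F p v) (differential F p w)
      = differential F p (curvatureTensor p u v w) := by
  have hs (v : TangentSpace 𝓘(ℝ, E) p) := contMDiffAt_extend (k := ∞) 𝓘(ℝ, E) E v
  have hN := curvatureAlong_eq (F := F) (hs u) (hs v) (SmoothAlongAt.differential (hs w))
  have hM := curvature_eq_curvatureTensor (hs u) (hs v) (hs w)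
  simp only [extend_apply_self] at hN hM
  rw [← hN, ← hM, curvatureAlong, hF.covDerivAlong_covDerivAlong_differential (hs v) (hs w),
    hF.covDerivAlong_covDerivAlong_differential (hs u) (hs w),
    hF.covDerivAlong_differential (mdifferentiableAt_extend 𝓘(ℝ, E) E w), curvature, map_sub,
    map_sub]

end SecondFundamentalForm

/-! ### The normal bundle -/

section Normal

variable {E : Type*} [NormedAddCommGroup E] [NormedSpace ℝ E]
  {M : Type*} [TopologicalSpace M] [ChartedSpace E M]
  {E' : Type*} [NormedAddCommGroup E'] [NormedSpace ℝ E']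
  {N : Type*} [TopologicalSpace N] [ChartedSpace E' N]
  [RiemannianBundle (fun x : N ↦ TangentSpace 𝓘(ℝ, E') x)]
  {J : Π x : N, TangentSpace 𝓘(ℝ, E') x →L[ℝ] TangentSpace 𝓘(ℝ, E') x}
  {F : C^∞⟮𝓘(ℝ, E), M; 𝓘(ℝ, E'), N⟯} {p : M} {X Y : Π q : M, TangentSpace 𝓘(ℝ, E) q}
  {ξ η : Π q : M, TangentSpace 𝓘(ℝ, E') (F q)} {v w : TangentSpace 𝓘(ℝ, E') (F p)}

theorem mem_normalSpace_iff :
    v ∈ normalSpace F p ↔ ∀ u, inner ℝ (differential F p u) v = 0 :=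
  ⟨fun h u ↦ h _ ⟨u, rfl⟩, fun h _ ⟨u, hu⟩ ↦ hu ▸ h u⟩

theorem IsTotallyReal.inner_eq_zero (hreal : IsTotallyReal J F) (u v : TangentSpace 𝓘(ℝ, E) p) :
    inner ℝ (differential F p u) (J (F p) (differential F p v)) = 0 :=
  mem_normalSpace_iff.1 (hreal p v) u

variable [FiniteDimensional ℝ E']

theorem normalPart_eq_zero_iff : normalPart F p v = 0 ↔ ∃ u, differential F p u = v := by
  rw [normalPart, Submodule.starProjection_apply_eq_zero_iff, normalSpace,
    Submodule.orthogonal_orthogonal]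
  rfl

theorem normalPart_differential (u : TangentSpace 𝓘(ℝ, E) p) :
    normalPart F p (differential F p u) = 0 :=
  normalPart_eq_zero_iff.2 ⟨u, rfl⟩

theorem normalPart_of_mem (hv : v ∈ normalSpace F p) : normalPart F p v = v :=
  Submodule.starProjection_eq_self_iff.2 hv

theorem normalPart_mem (v : TangentSpace 𝓘(ℝ, E') (F p)) : normalPart F p v ∈ normalSpace F p :=
  Submodule.starProjection_apply_mem _ _

theorem normalPart_add (v w : TangentSpace 𝓘(ℝ, E') (F p)) :
    normalPart F p (v + w) = normalPart F p v + normalPart F p w :=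
  map_add _ _ _

theorem inner_normalPart_left (hw : w ∈ normalSpace F p) :
    inner ℝ (normalPart F p v) w = inner ℝ v w := by
  conv_rhs => rw [← normalPart_of_mem hw]
  exact Submodule.inner_starProjection_left_eq_right _ v w

variable [IsManifold 𝓘(ℝ, E') ∞ N]
  [IsContMDiffRiemannianBundle 𝓘(ℝ, E') ∞ E' (fun x : N ↦ TangentSpace 𝓘(ℝ, E') x)]

theorem normalConn_congr (h : ∀ᶠ q in 𝓝 p, ξ q = η q) (u : TangentSpace 𝓘(ℝ, E) p) :
    normalConn F ξ p u = normalConn F η p u := by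
  rw [normalConn, normalConn, covDerivAlong_congr h]

theorem normalCurvature_congr (h : ∀ᶠ q in 𝓝 p, ξ q = η q) :
    normalCurvature F X Y ξ p = normalCurvature F X Y η p := by
  have hconn (Z : Π q : M, TangentSpace 𝓘(ℝ, E) q) :
      ∀ᶠ q in 𝓝 p, normalConn F ξ q (Z q) = normalConn F η q (Z q) :=
    h.eventually_nhds.mono fun q hq ↦ normalConn_congr hq _
  rw [normalCurvature, normalCurvature, normalConn_congr (hconn Y), normalConn_congr (hconn X),
    normalConn_congr h]

theorem IsKaehler.normalF_map_differential (hJ : IsKaehler J) (u : TangentSpace 𝓘(ℝ, E) p) :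
    normalF J F p (J (F p) (differential F p u)) = 0 := by
  rw [normalF, hJ.sq, ← map_neg, normalPart_differential]

end Normal

/-! ### Totally real submanifolds of Kähler manifolds -/

section ParallelF

variable {E : Type*} [NormedAddCommGroup E] [NormedSpace ℝ E]
  {M : Type*} [TopologicalSpace M] [ChartedSpace E M]
  {E' : Type*} [NormedAddCommGroup E'] [NormedSpace ℝ E'] [FiniteDimensional ℝ E']
  {N : Type*} [TopologicalSpace N] [ChartedSpace E' N] [IsManifold 𝓘(ℝ, E') ∞ N]
  [RiemannianBundle (fun x : N ↦ TangentSpace 𝓘(ℝ, E') x)]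
  [IsContMDiffRiemannianBundle 𝓘(ℝ, E') ∞ E' (fun x : N ↦ TangentSpace 𝓘(ℝ, E') x)]
  {J : Π x : N, TangentSpace 𝓘(ℝ, E') x →L[ℝ] TangentSpace 𝓘(ℝ, E') x}
  {F : C^∞⟮𝓘(ℝ, E), M; 𝓘(ℝ, E'), N⟯} {p : M}

theorem IsKaehler.normalF_eq_zero_of_normalF_normalF (hJ : IsKaehler J)
    {ξ : TangentSpace 𝓘(ℝ, E') (F p)} (hξ : ξ ∈ normalSpace F p)
    (h : normalF J F p (normalF J F p ξ) = 0) : normalF J F p ξ = 0 := by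
  have hf : normalF J F p ξ ∈ normalSpace F p := normalPart_mem _
  rw [← inner_self_eq_zero (𝕜 := ℝ)]
  calc inner ℝ (normalF J F p ξ) (normalF J F p ξ)
      = inner ℝ (J (F p) ξ) (normalF J F p ξ) := inner_normalPart_left hf
    _ = -inner ℝ ξ (J (F p) (normalF J F p ξ)) := hJ.inner_skew _ _
    _ = -inner ℝ (J (F p) (normalF J F p ξ)) ξ := by rw [real_inner_comm]
    _ = -inner ℝ (normalF J F p (normalF J F p ξ)) ξ :=
      congrArg Neg.neg (inner_normalPart_left hξ).symm
    _ = 0 := by rw [h, inner_zero_left, neg_zero]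

variable [FiniteDimensional ℝ E] [IsManifold 𝓘(ℝ, E) ∞ M]
  [RiemannianBundle (fun x : M ↦ TangentSpace 𝓘(ℝ, E) x)]
  [IsContMDiffRiemannianBundle 𝓘(ℝ, E) ∞ E (fun x : M ↦ TangentSpace 𝓘(ℝ, E) x)]
  {X Y W : Π q : M, TangentSpace 𝓘(ℝ, E) q}

theorem covDerivAlong_kaehler_differential (hJ : IsKaehler J) (hY : MDiffAt (T% Y) p)
    (u : TangentSpace 𝓘(ℝ, E) p) :
    covDerivAlong F (fun q ↦ J (F q) (differential F q (Y q))) p u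
      = J (F p) (differential F p (leviCivita Y p u)) + J (F p) (sffTensor F p u (Y p)) := by
  rw [covDerivAlong_kaehler hJ (MDiffAlongAt.differential hY), covDerivAlong_differential hY,
    map_add]

theorem IsTotallyReal.normalConn_kaehler_differential (hreal : IsTotallyReal J F)
    (hJ : IsKaehler J) (hY : MDiffAt (T% Y) p) (u : TangentSpace 𝓘(ℝ, E) p) :
    normalConn F (fun q ↦ J (F q) (differential F q (Y q))) p u
      = J (F p) (differential F p (leviCivita Y p u)) + normalF J F p (sffTensor F p u (Y p)) := by
  rw [normalConn, covDerivAlong_kaehler_differential hJ hY, normalPart_add,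
    normalPart_of_mem (hreal p _), normalF]

theorem IsTotallyReal.inner_sffTensor_swap (hreal : IsTotallyReal J F) (hJ : IsKaehler J)
    (u v w : TangentSpace 𝓘(ℝ, E) p) :
    inner ℝ (sffTensor F p u v) (J (F p) (differential F p w))
      = inner ℝ (sffTensor F p u w) (J (F p) (differential F p v)) := by
  have hd (v : TangentSpace 𝓘(ℝ, E) p) := mdifferentiableAt_extend 𝓘(ℝ, E) E v
  have horth := mvfderiv_inner_along (MDiffAlongAt.differential (F := F) (hd v))
    ((MDiffAlongAt.differential (F := F) (hd w)).kaehler hJ) u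
  simp only [hreal.inner_eq_zero] at horth
  rw [mvfderiv_const, covDerivAlong_differential (hd v),
    covDerivAlong_kaehler_differential hJ (hd w), inner_add_left, inner_add_right] at horth
  simp only [extend_apply_self, hreal.inner_eq_zero, zero_add, zero_apply] at horth
  linarith [hJ.inner_skew (differential F p v) (sffTensor F p u w),
    real_inner_comm (sffTensor F p u w) (J (F p) (differential F p v))]

theorem HasParallelNormalF.normalF_sffTensor (hf : HasParallelNormalF J F) (hJ : IsKaehler J)
    (hF : IsIsometricImmersion F) (hreal : IsTotallyReal J F) (u v : TangentSpace 𝓘(ℝ, E) p) :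
    normalF J F p (sffTensor F p u v) = 0 := by
  have hv := contMDiffAt_extend (k := ∞) 𝓘(ℝ, E) E v
  have hparallel := hf p u (fun q ↦ J (F q) (differential F q (extend E v q)))
    (fun q ↦ hreal q _) ((SmoothAlongAt.differential hv).kaehler hJ)
  simp only [hJ.normalF_map_differential] at hparallel
  rw [normalConn, covDerivAlong_zero, hreal.normalConn_kaehler_differential hJ
    (ContMDiffAt.mdifferentiableAt hv (by simp)), extend_apply_self, normalF, map_add,
    normalPart_add, ← normalF, hJ.normalF_map_differential, zero_add] at hparallel
  refine hJ.normalF_eq_zero_of_normalF_normalF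
    (mem_normalSpace_iff.2 fun w ↦ ?_) (hparallel.symm.trans (map_zero _))
  rw [real_inner_comm, inner_sffTensor_differential hF]

theorem HasParallelNormalF.exists_sffTensor_eq (hf : HasParallelNormalF J F) (hJ : IsKaehler J)
    (hF : IsIsometricImmersion F) (hreal : IsTotallyReal J F) (u v : TangentSpace 𝓘(ℝ, E) p) :
    ∃ a, sffTensor F p u v = J (F p) (differential F p a) := by
  obtain ⟨b, hb⟩ := normalPart_eq_zero_iff.1 (hf.normalF_sffTensor hJ hF hreal u v)
  exact ⟨-b, by rw [map_neg, hb, map_neg, hJ.sq, neg_neg]⟩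

theorem HasParallelNormalF.normalConn_kaehler_differential (hf : HasParallelNormalF J F)
    (hJ : IsKaehler J) (hF : IsIsometricImmersion F) (hreal : IsTotallyReal J F)
    (hW : MDiffAt (T% W) p) (u : TangentSpace 𝓘(ℝ, E) p) :
    normalConn F (fun q ↦ J (F q) (differential F q (W q))) p u
      = J (F p) (differential F p (leviCivita W p u)) := by
  rw [hreal.normalConn_kaehler_differential hJ hW, hf.normalF_sffTensor hJ hF hreal, add_zero]

theorem HasParallelNormalF.normalConn_normalConn_kaehler_differential
    (hf : HasParallelNormalF J F) (hJ : IsKaehler J) (hF : IsIsometricImmersion F)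
    (hreal : IsTotallyReal J F) (hX : CMDiffAt ∞ (T% X) p) (hW : CMDiffAt ∞ (T% W) p)
    (u : TangentSpace 𝓘(ℝ, E) p) :
    normalConn F (fun q ↦ normalConn F (fun q ↦ J (F q) (differential F q (W q))) q (X q)) p u
      = J (F p) (differential F p (leviCivita (fun q ↦ leviCivita W q (X q)) p u)) := by
  rw [← hf.normalConn_kaehler_differential hJ hF hreal
    (ContMDiffAt.mdifferentiableAt (contMDiffAt_leviCivita hX hW) (by simp))]
  refine normalConn_congr ?_ u
  filter_upwards [eventually_mdifferentiableAt_section hW] with q hq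
  exact hf.normalConn_kaehler_differential hJ hF hreal hq _

theorem HasParallelNormalF.normalCurvature_kaehler_differential (hf : HasParallelNormalF J F)
    (hJ : IsKaehler J) (hF : IsIsometricImmersion F) (hreal : IsTotallyReal J F)
    (hX : CMDiffAt ∞ (T% X) p) (hY : CMDiffAt ∞ (T% Y) p) (hW : CMDiffAt ∞ (T% W) p) :
    normalCurvature F X Y (fun q ↦ J (F q) (differential F q (W q))) p
      = J (F p) (differential F p (curvatureTensor p (X p) (Y p) (W p))) := by
  rw [normalCurvature, hf.normalConn_normalConn_kaehler_differential hJ hF hreal hY hW,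
    hf.normalConn_normalConn_kaehler_differential hJ hF hreal hX hW,
    hf.normalConn_kaehler_differential hJ hF hreal (ContMDiffAt.mdifferentiableAt hW (by simp)),
    ← curvature_eq_curvatureTensor hX hY hW, curvature, map_sub, map_sub, map_sub, map_sub]

end ParallelF

/-! ### The cubic form of a totally real submanifold -/

section SymmetricCubicForm

variable {V : Type*} [NormedAddCommGroup V] [InnerProductSpace ℝ V]

theorem exists_ne_zero_inner_eq_zero (hV : 1 < finrank ℝ V) (x : V) :
    ∃ y : V, y ≠ 0 ∧ inner ℝ x y = 0 := by
  have : FiniteDimensional ℝ V := .of_finrank_pos (by lia)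
  have hdim := Submodule.finrank_add_finrank_orthogonal (ℝ ∙ x)
  have hspan := finrank_span_le_card (R := ℝ) ({x} : Set V)
  rw [Set.toFinset_singleton, Finset.card_singleton] at hspan
  have hne : (ℝ ∙ x)ᗮ ≠ ⊥ := by
    intro h
    rw [h, finrank_bot] at hdim
    lia
  obtain ⟨y, hy, hy0⟩ := Submodule.exists_mem_ne_zero_of_ne_bot hne
  exact ⟨y, hy0, Submodule.mem_orthogonal_singleton_iff_inner_right.1 hy⟩

/-- A symmetric trilinear form, i.e. the polarization of a cubic form. -/
structure IsSymmetricCubic (C : V →ₗ[ℝ] V →ₗ[ℝ] V →ₗ[ℝ] ℝ) : Prop where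
  swap_left : ∀ u v w, C u v w = C v u w
  swap_right : ∀ u v w, C u v w = C u w v

/-- Infinitesimal invariance of a trilinear form under the rotations of `V`: the derivation
extending `z ↦ ⟨y, z⟩ x - ⟨x, z⟩ y`, which generates the rotations in the plane of `x` and `y`,
annihilates `C`. -/
def IsRotationInvariant (C : V →ₗ[ℝ] V →ₗ[ℝ] V →ₗ[ℝ] ℝ) : Prop :=
  ∀ x y z u t, C (inner ℝ y z • x - inner ℝ x z • y) u t
    + C z (inner ℝ y u • x - inner ℝ x u • y) t + C z u (inner ℝ y t • x - inner ℝ x t • y) = 0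

namespace IsSymmetricCubic

variable {C : V →ₗ[ℝ] V →ₗ[ℝ] V →ₗ[ℝ] ℝ}

theorem eq_zero_of_apply_self (hC : IsSymmetricCubic C) (h : ∀ x, C x x x = 0) (u v w : V) :
    C u v w = 0 := by
  have huvw := h (u + v + w)
  have huv := h (u + v)
  have huw := h (u + w)
  have hvw := h (v + w)
  simp only [map_add, LinearMap.add_apply] at huvw huv huw hvw
  linarith [h u, h v, h w, hC.swap_left u v w, hC.swap_left u w v, hC.swap_left v w u,
    hC.swap_right u v w, hC.swap_right v u w, hC.swap_right w u v]

theorem apply_self_left_eq_zero (hC : IsSymmetricCubic C) (hinv : IsRotationInvariant C) {x y : V}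
    (hxy : inner ℝ x y = 0) : C x x y = 0 := by
  by_cases hx : x = 0
  · simp [hx]
  have hrot := hinv x y x x x
  simp only [real_inner_comm x y, hxy, zero_smul, zero_sub, map_neg, map_smul,
    LinearMap.neg_apply, LinearMap.smul_apply, smul_eq_mul] at hrot
  rw [hC.swap_left y, ← hC.swap_right x x y] at hrot
  have hprod : inner ℝ x x * C x x y = 0 := by linarith
  exact (mul_eq_zero.1 hprod).resolve_left (inner_self_ne_zero.2 hx)

theorem apply_self_eq_zero (hC : IsSymmetricCubic C) (hinv : IsRotationInvariant C)
    (hV : 1 < finrank ℝ V) (x : V) : C x x x = 0 := by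
  obtain ⟨y, hy, hxy⟩ := exists_ne_zero_inner_eq_zero hV x
  have hyyx : C y y x = 0 := hC.apply_self_left_eq_zero hinv (by rw [real_inner_comm, hxy])
  have hrot := hinv x y x x y
  simp only [real_inner_comm x y, hxy, zero_smul, zero_sub, sub_zero, map_neg, map_smul,
    LinearMap.neg_apply, LinearMap.smul_apply, smul_eq_mul] at hrot
  rw [hC.swap_left x y y, hC.swap_right y x y, hyyx] at hrot
  have hprod : inner ℝ y y * C x x x = 0 := by linarith
  exact (mul_eq_zero.1 hprod).resolve_left (inner_self_ne_zero.2 hy)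

end IsSymmetricCubic

end SymmetricCubicForm

section CubicForm

variable {E : Type*} [NormedAddCommGroup E] [NormedSpace ℝ E] [FiniteDimensional ℝ E]
  {M : Type*} [TopologicalSpace M] [ChartedSpace E M] [IsManifold 𝓘(ℝ, E) ∞ M]
  [RiemannianBundle (fun x : M ↦ TangentSpace 𝓘(ℝ, E) x)]
  [IsContMDiffRiemannianBundle 𝓘(ℝ, E) ∞ E (fun x : M ↦ TangentSpace 𝓘(ℝ, E) x)]
  {E' : Type*} [NormedAddCommGroup E'] [NormedSpace ℝ E'] [FiniteDimensional ℝ E']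
  {N : Type*} [TopologicalSpace N] [ChartedSpace E' N] [IsManifold 𝓘(ℝ, E') ∞ N]
  [RiemannianBundle (fun x : N ↦ TangentSpace 𝓘(ℝ, E') x)]
  [IsContMDiffRiemannianBundle 𝓘(ℝ, E') ∞ E' (fun x : N ↦ TangentSpace 𝓘(ℝ, E') x)]
  {J : Π x : N, TangentSpace 𝓘(ℝ, E') x →L[ℝ] TangentSpace 𝓘(ℝ, E') x}
  {F : C^∞⟮𝓘(ℝ, E), M; 𝓘(ℝ, E'), N⟯} {p : M} {X Y Z U W : Π q : M, TangentSpace 𝓘(ℝ, E) q}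

/-- The trilinear form `⟨σ(u, v), J w⟩` on `T_p M`. It determines `σ` when `σ` takes values in
`J T_p M`. -/
def cubicForm (J : Π x : N, TangentSpace 𝓘(ℝ, E') x →L[ℝ] TangentSpace 𝓘(ℝ, E') x)
    (F : C^∞⟮𝓘(ℝ, E), M; 𝓘(ℝ, E'), N⟯) (p : M) : TangentSpace 𝓘(ℝ, E) p →ₗ[ℝ]
    TangentSpace 𝓘(ℝ, E) p →ₗ[ℝ] TangentSpace 𝓘(ℝ, E) p →ₗ[ℝ] ℝ :=
  (sffTensor F p).compr₂ ((innerₗ (TangentSpace 𝓘(ℝ, E') (F p))).compl₂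
    ((J (F p)).toLinearMap ∘ₗ (differential F p).toLinearMap))

theorem cubicForm_apply (u v w : TangentSpace 𝓘(ℝ, E) p) :
    cubicForm J F p u v w = inner ℝ (sffTensor F p u v) (J (F p) (differential F p w)) :=
  rfl

theorem IsTotallyReal.isSymmetricCubic_cubicForm (hreal : IsTotallyReal J F) (hJ : IsKaehler J)
    (p : M) : IsSymmetricCubic (V := TangentSpace 𝓘(ℝ, E) p) (cubicForm J F p) where
  swap_left u v w := by rw [cubicForm_apply, cubicForm_apply, sffTensor_comm]
  swap_right := hreal.inner_sffTensor_swap hJ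

theorem smoothAlongAt_secondFundamentalForm (hX : CMDiffAt ∞ (T% X) p)
    (hY : CMDiffAt ∞ (T% Y) p) : SmoothAlongAt F (secondFundamentalForm F X Y) p :=
  ((SmoothAlongAt.differential hY).covDerivAlong hX).sub
    (SmoothAlongAt.differential (contMDiffAt_leviCivita hX hY))

theorem contMDiffAt_curvature (hX : CMDiffAt ∞ (T% X) p) (hY : CMDiffAt ∞ (T% Y) p)
    (hZ : CMDiffAt ∞ (T% Z) p) : CMDiffAt ∞ (T% (curvature X Y Z)) p :=
  ((contMDiffAt_leviCivita hX (contMDiffAt_leviCivita hY hZ)).sub_section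
    (contMDiffAt_leviCivita hY (contMDiffAt_leviCivita hX hZ))).sub_section
    (contMDiffAt_leviCivita (contMDiffAt_mlieBracket hX hY) hZ)

theorem contMDiffAt_of_kaehler_differential (hJ : IsKaehler J) (hF : IsIsometricImmersion F)
    (hW : SmoothAlongAt F (fun q ↦ J (F q) (differential F q (W q))) p) :
    CMDiffAt ∞ (T% W) p := by
  refine contMDiffAt_of_inner fun T hT ↦ ?_
  simpa only [hJ.isometry, hF _ _ _] using
    ((SmoothAlongAt.differential (F := F) hT).kaehler hJ).inner hW

theorem HasParallelNormalF.inner_normalCurvature_secondFundamentalForm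
    (hf : HasParallelNormalF J F) (hJ : IsKaehler J) (hF : IsIsometricImmersion F)
    (hreal : IsTotallyReal J F) (hX : CMDiffAt ∞ (T% X) p) (hY : CMDiffAt ∞ (T% Y) p)
    (hZ : CMDiffAt ∞ (T% Z) p) (hU : CMDiffAt ∞ (T% U) p) (t : TangentSpace 𝓘(ℝ, E) p) :
    inner ℝ (normalCurvature F X Y (secondFundamentalForm F Z U) p)
        (J (F p) (differential F p t)) =
      -cubicForm J F p (Z p) (U p) (curvatureTensor p (X p) (Y p) t) := by
  -- `σ(Z, U) = J W` for a smooth tangent field `W`, whence `R^⊥(X, Y)σ(Z, U) = J R(X, Y)W`.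
  choose W hW using fun q ↦ hf.exists_sffTensor_eq hJ hF hreal (Z q) (U q)
  have hσ : ∀ᶠ q in 𝓝 p, secondFundamentalForm F Z U q = J (F q) (differential F q (W q)) := by
    filter_upwards [eventually_mdifferentiableAt_section hU] with q hq
    rw [secondFundamentalForm_eq_sffTensor hq, hW]
  have hWs : CMDiffAt ∞ (T% W) p :=
    contMDiffAt_of_kaehler_differential hJ hF ((smoothAlongAt_secondFundamentalForm hZ hU).congr hσ)
  rw [normalCurvature_congr hσ, hf.normalCurvature_kaehler_differential hJ hF hreal hX hY hWs,
    cubicForm_apply, hW, hJ.isometry, hJ.isometry, hF, hF]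
  exact ((isCurvatureLike_curvatureTensor p).inner_skew (V := TangentSpace 𝓘(ℝ, E) p) _ _ _ _).trans
    (by rw [real_inner_comm])

theorem IsSemiparallel.cubicForm_curvatureTensor (hsemi : IsSemiparallel F)
    (hf : HasParallelNormalF J F) (hJ : IsKaehler J) (hF : IsIsometricImmersion F)
    (hreal : IsTotallyReal J F) (x y z u t : TangentSpace 𝓘(ℝ, E) p) :
    cubicForm J F p (curvatureTensor p x y z) u t + cubicForm J F p z (curvatureTensor p x y u) t
      + cubicForm J F p z u (curvatureTensor p x y t) = 0 := by
  have hs (v : TangentSpace 𝓘(ℝ, E) p) := contMDiffAt_extend (k := ∞) 𝓘(ℝ, E) E v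
  have hσ := congrArg (fun s ↦ inner ℝ s (J (F p) (differential F p t)))
    (hsemi p _ _ _ _ (hs x) (hs y) (hs z) (hs u))
  simp only [inner_sub_left, inner_zero_left] at hσ
  rw [hf.inner_normalCurvature_secondFundamentalForm hJ hF hreal (hs x) (hs y) (hs z) (hs u),
    secondFundamentalForm_eq_sffTensor (ContMDiffAt.mdifferentiableAt (hs u) (by simp)),
    secondFundamentalForm_eq_sffTensor (ContMDiffAt.mdifferentiableAt
      (contMDiffAt_curvature (hs x) (hs y) (hs u)) (by simp)),
    curvature_eq_curvatureTensor (hs x) (hs y) (hs z),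
    curvature_eq_curvatureTensor (hs x) (hs y) (hs u)] at hσ
  simp only [extend_apply_self, ← cubicForm_apply] at hσ
  linarith

theorem HasConstantCurvature.isRotationInvariant_cubicForm {c : ℝ}
    (hc : HasConstantCurvature E M c) (hc0 : c ≠ 0) (hsemi : IsSemiparallel F)
    (hf : HasParallelNormalF J F) (hJ : IsKaehler J) (hF : IsIsometricImmersion F)
    (hreal : IsTotallyReal J F) (p : M) :
    IsRotationInvariant (V := TangentSpace 𝓘(ℝ, E) p) (cubicForm J F p) := fun x y z u t ↦ by
  have hR := hsemi.cubicForm_curvatureTensor hf hJ hF hreal x y z u t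
  simp only [hc.curvatureTensor_eq, mul_smul, ← smul_sub, map_smul, LinearMap.smul_apply] at hR
  rw [← smul_add, ← smul_add] at hR
  exact (smul_eq_zero.1 hR).resolve_left hc0

theorem HasParallelNormalF.sffTensor_eq_zero (hf : HasParallelNormalF J F) (hJ : IsKaehler J)
    (hF : IsIsometricImmersion F) (hreal : IsTotallyReal J F) (h : ∀ u, cubicForm J F p u u u = 0) :
    sffTensor F p = 0 := by
  ext u v
  obtain ⟨a, ha⟩ := hf.exists_sffTensor_eq hJ hF hreal u v
  have hC := (hreal.isSymmetricCubic_cubicForm hJ p).eq_zero_of_apply_self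
    (V := TangentSpace 𝓘(ℝ, E) p) h u v a
  rw [cubicForm_apply, ← ha] at hC
  exact inner_self_eq_zero.1 hC

theorem HasConstantCurvature.isTotallyGeodesic {c : ℝ} (hc : HasConstantCurvature E M c)
    (hc0 : c ≠ 0) (hE : 1 < finrank ℝ E) (hsemi : IsSemiparallel F)
    (hf : HasParallelNormalF J F) (hJ : IsKaehler J) (hF : IsIsometricImmersion F)
    (hreal : IsTotallyReal J F) : IsTotallyGeodesic F :=
  isTotallyGeodesic_iff.2 fun p ↦ hf.sffTensor_eq_zero hJ hF hreal
    ((hreal.isSymmetricCubic_cubicForm hJ p).apply_self_eq_zero (V := TangentSpace 𝓘(ℝ, E) p)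
      (hc.isRotationInvariant_cubicForm hc0 hsemi hf hJ hF hreal p) hE)

theorem IsTotallyGeodesic.eq_div_four [Nonempty M] {c μ : ℝ} (hgeo : IsTotallyGeodesic F)
    (hE : 1 < finrank ℝ E) (hc : HasConstantCurvature E M c) (hN : IsComplexSpaceForm J μ)
    (hF : IsIsometricImmersion F) (hreal : IsTotallyReal J F) : c = μ / 4 := by
  obtain ⟨p⟩ := ‹Nonempty M›
  have : Nontrivial (TangentSpace 𝓘(ℝ, E) p) :=
    Module.nontrivial_of_finrank_pos (R := ℝ) (M := E) (by lia)
  obtain ⟨x, hx⟩ := exists_ne (0 : TangentSpace 𝓘(ℝ, E) p)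
  obtain ⟨y, hy, hxy⟩ := exists_ne_zero_inner_eq_zero (V := TangentSpace 𝓘(ℝ, E) p) hE x
  have hJ := hN.isKaehler
  have hR := (isCurvatureLike_curvatureTensor (F p)).inner_eq_of_totallyReal
    (V := TangentSpace 𝓘(ℝ, E') (F p)) (hJ.isometry (F p)) hJ.curvatureTensor_comm (hJ.sq (F p))
    hN.inner_curvatureTensor (u := differential F p x) (v := differential F p y)
    (by rw [hF, hxy]) (hreal.inner_eq_zero x y)
  rw [hgeo.curvatureTensor_differential, hF, hF, hF, hc.curvatureTensor_eq, hxy, mul_zero,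
    zero_smul, sub_zero, real_inner_smul_left] at hR
  refine mul_right_cancel₀
    (mul_ne_zero (inner_self_ne_zero (𝕜 := ℝ).2 hx) (inner_self_ne_zero (𝕜 := ℝ).2 hy)) ?_
  linarith

theorem HasConstantCurvature.isFlat (hc : HasConstantCurvature E M 0) : IsFlat E M :=
  fun _ _ _ _ hX hY hZ ↦ by
    simp [curvature_eq_curvatureTensor hX hY hZ, hc.curvatureTensor_eq]

end CubicForm

end TotallyReal

end

theorem mainTheorem4
    {n m : ℕ} (hn : 1 < n)
    -- the Riemannian manifold `M` of dimension `n`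
    {E : Type*} [NormedAddCommGroup E] [NormedSpace ℝ E] [FiniteDimensional ℝ E]
    (hE : Module.finrank ℝ E = n)
    {M : Type*} [TopologicalSpace M] [ChartedSpace E M] [IsManifold 𝓘(ℝ, E) ∞ M] [Nonempty M]
    [RiemannianBundle (fun x : M ↦ TangentSpace 𝓘(ℝ, E) x)]
    [IsContMDiffRiemannianBundle 𝓘(ℝ, E) ∞ E (fun x : M ↦ TangentSpace 𝓘(ℝ, E) x)]
    -- the Riemannian manifold `N` of dimension `2m`
    {E' : Type*} [NormedAddCommGroup E'] [NormedSpace ℝ E'] [FiniteDimensional ℝ E']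
    (hE' : Module.finrank ℝ E' = 2 * m)
    {N : Type*} [TopologicalSpace N] [ChartedSpace E' N] [IsManifold 𝓘(ℝ, E') ∞ N]
    [RiemannianBundle (fun x : N ↦ TangentSpace 𝓘(ℝ, E') x)]
    [IsContMDiffRiemannianBundle 𝓘(ℝ, E') ∞ E' (fun x : N ↦ TangentSpace 𝓘(ℝ, E') x)]
    (J : Π x : N, TangentSpace 𝓘(ℝ, E') x →L[ℝ] TangentSpace 𝓘(ℝ, E') x) (μ : ℝ)
    (hN : TotallyReal.IsComplexSpaceForm J μ)
    (F : C^∞⟮𝓘(ℝ, E), M; 𝓘(ℝ, E'), N⟯) (hF : TotallyReal.IsIsometricImmersion F)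
    (hreal : TotallyReal.IsTotallyReal J F)
    (hsemi : TotallyReal.IsSemiparallel F)
    (c : ℝ) (hc : TotallyReal.HasConstantCurvature E M c)
    (hf : TotallyReal.HasParallelNormalF J F) :
    (c = 0 ∧ TotallyReal.IsFlat E M) ∨ (TotallyReal.IsTotallyGeodesic F ∧ c = μ / 4) := by
  have hn' : 1 < Module.finrank ℝ E := by rwa [hE]
  by_cases hc0 : c = 0
  · subst hc0
    exact .inl ⟨rfl, hc.isFlat⟩
  · have hgeo := hc.isTotallyGeodesic hc0 hn' hsemi hf hN.isKaehler hF hreal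
    exact .inr ⟨hgeo, hgeo.eq_div_four hn' hc hN hF hreal⟩
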